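/- Let $P,\mu:(0,+\infty)\to(0,+\infty)$ be $C^2$ functions with $P'(\rho)>0$ for all $\rho>0$ and $P((0,+\infty))=(0,+\infty)$. For $\rho^*>0$ and $\rho>0$ put $$Q(\rho)=\rho\int_{\rho^*}^{\rho}\frac{P(\tau)}{\tau^2}\,d\tau-\frac{P(\rho^*)}{\rho^*}\rho+P(\rho^*),\qquad k(\rho)=\int_{\rho^*}^{\rho}\frac{\mu(\tau)}{\tau}\,d\tau,\qquad G(\rho)=\int_{\rho^*}^{\rho}\frac{\mu(l)}{l^{3/2}}\sqrt{Q(l)}\,dl,$$ and assume (H): for every $\rho^*>0$, $\lim_{\rho\to+\infty}G(\rho)=+\infty$, $\lim_{\rho\to0^+}G(\rho)=-\infty$ and $\lim_{\rho\to+\infty}k(\rho)=+\infty$. Let $P_{ext}>0$. For an input $u\in C^0([0,+\infty))$, a *classical solution* of the two-piston system consists of functions $a,b\in C^1([0,+\infty))\cap C^2((0,+\infty))$ with $a(t)<b(t)$ for all $t\ge0$ and, with $\Omega=\bigcup_{t>0}\{t\}\times(a(t),b(t))$, $\tilde\Omega=\bigcup_{t>0}\{t\}\times[a(t),b(t)]$,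 $\bar\Omega=\bigcup_{t\ge0}\{t\}\times[a(t),b(t)]$, functions $\rho\in C^1(\bar\Omega;(0,+\infty))\cap C^2(\Omega)$ and $v\in C^0(\bar\Omega)\cap C^1(\tilde\Omega)$ with $v(t,\cdot)\in C^2((a(t),b(t)))$ for each $t>0$, such that $$\rho_t+(\rho v)_x=0,\qquad \rho v_t+\rho v v_x=\big(\mu(\rho)v_x-P(\rho)\big)_x\qquad\text{for } t>0,\ x\in(a(t),b(t)),$$ $$\dot a(t)=v(t,a(t)),\quad \dot b(t)=v(t,b(t)),\quad \int_{a(t)}^{b(t)}\rho(t,x)\,dx=1\qquad\text{for } t\ge0,$$ $$\ddot b(t)=P(\rho(t,b(t)))-\mu(\rho(t,b(t)))v_x(t,b(t))-P_{ext},\quad \ddot a(t)=u(t)+P_{ext}-P(\rho(t,a(t)))+\mu(\rho(t,a(t)))v_x(t,a(t))\qquad\text{for } t>0.$$ (Here $C^1(A)$, for $A$ between an open set and its closure, means continuous on $A$ and continuously differentiable in the open set with derivatives extending continuously to $A$; derivatives at boundary points are these extensions.) From now on let $\rho^*>0$ be the unique solution of $P(\rho^*)=P_{ext}$. For $r>0$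 let $V=W+rE$, where for a density profile $\rho$ and a velocity profile $v$ on $[a,b]$ $$U=\int_a^bQ(\rho(x))\,dx,\qquad E=\frac{v^2(a)}2+\frac{v^2(b)}2+\frac12\int_a^b\rho(x) v^2(x)\,dx+U,$$ $$W=\frac12\int_a^b\frac1{\rho(x)}\Big(\rho(x) v(x)+\frac{\partial}{\partial x}k(\rho(x))\Big)^2dx+\frac12\big(v(b)-k(\rho(b))\big)^2+\frac12\big(v(a)+k(\rho(a))\big)^2+U.$$ Let $\Phi(a,b,\rho,v)=(\tilde\rho,\tilde v)$ with $\tilde\rho(\theta)=\rho(a+(b-a)\theta)$, $\tilde v(\theta)=v(a+(b-a)\theta)$ for $\theta\in[0,1]$, and $$\|(\rho,v)\|_X=\sqrt{v^2(0)+v^2(1)}+\Big(\int_0^1v^2(\theta)\,d\theta\Big)^{1/2}+\max_{0\le\theta\le1}|\rho(\theta)|+\Big(\int_0^1(\rho'(\theta))^2\,d\theta\Big)^{1/2}.$$ **Theorem.** Suppose that (H) holds and that (A) holds: $K>0$ is a constant with $|k(\rho)|\le K|P(\rho)-P(\rho^*)|$ for all $\rho>0$. Then for every $R>0$ and $S\ge0$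 there exist constants $M,\sigma>0$ (for the given $P,\mu$ depending only on $\rho^*,R,K,S$) such that for every $r\ge RK/2$ and every classical solution with $u(t)=-Rv(t,a(t))$ for $t>0$ and $V(a(0),b(0),\rho(0,\cdot),v(0,\cdot))\le S$, the following estimate holds for all $t\ge0$: $$\big\|\Phi(a(t),b(t),\rho(t,\cdot),v(t,\cdot))-(\rho^*,0)\big\|_X\le M e^{-\sigma t}\big\|\Phi(a(0),b(0),\rho(0,\cdot),v(0,\cdot))-(\rho^*,0)\big\|_X .$$ -/

import Mathlib

open Set

noncomputable section

namespace TwoPiston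

/-- The potential energy density
`Q(ρ) = ρ ∫_{ρ*}^{ρ} P(τ)/τ² dτ - (P(ρ*)/ρ*) ρ + P(ρ*)`. -/
def Q (P : ℝ → ℝ) (ρs ρ : ℝ) : ℝ :=
  ρ * (∫ τ in ρs..ρ, P τ / τ ^ 2) - P ρs / ρs * ρ + P ρs

/-- `k(ρ) = ∫_{ρ*}^{ρ} μ(τ)/τ dτ`. -/
def k (μ : ℝ → ℝ) (ρs ρ : ℝ) : ℝ := ∫ τ in ρs..ρ, μ τ / τ

/-- `G(ρ) = ∫_{ρ*}^{ρ} μ(l) l^{-3/2} √Q(l) dl`. -/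
def G (P μ : ℝ → ℝ) (ρs ρ : ℝ) : ℝ :=
  ∫ l in ρs..ρ, μ l / l ^ (3 / 2 : ℝ) * √(Q P ρs l)

/-- The standing assumption on the pressure law `P` and the viscosity law `μ`.
Only the values on `(0, +∞)` matter. -/
structure AssumptionH (P μ : ℝ → ℝ) : Prop where
  contDiff_P : ContDiffOn ℝ 2 P (Ioi 0)
  contDiff_μ : ContDiffOn ℝ 2 μ (Ioi 0)
  μ_pos : ∀ ρ, 0 < ρ → 0 < μ ρ
  deriv_P_pos : ∀ ρ, 0 < ρ → 0 < deriv P ρ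
  image_P : P '' Ioi 0 = Ioi 0
  tendsto_G_atTop : ∀ ρs, 0 < ρs → Filter.Tendsto (G P μ ρs) Filter.atTop Filter.atTop
  tendsto_G_zero : ∀ ρs, 0 < ρs → Filter.Tendsto (G P μ ρs) (nhdsWithin 0 (Ioi 0)) Filter.atBot
  tendsto_k_atTop : ∀ ρs, 0 < ρs → Filter.Tendsto (k μ ρs) Filter.atTop Filter.atTop

/-- Class `C¹(A)` for `S` open with `S ⊆ A ⊆ closure S`: continuous on `A`, continuously
differentiable in `S`, the derivative having a continuous extension to `A`. -/
def C1UpTo {E : Type*} [NormedAddCommGroup E] [NormedSpace ℝ E]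
    (S A : Set E) (f : E → ℝ) : Prop :=
  ContinuousOn f A ∧ ContDiffOn ℝ 1 f S ∧
    ∃ g : E → (E →L[ℝ] ℝ), ContinuousOn g A ∧ ∀ p ∈ S, g p = fderiv ℝ f p

/-- `Ω = ⋃_{t > 0} {t} × (a(t), b(t))`. -/
def openDomain (a b : ℝ → ℝ) : Set (ℝ × ℝ) :=
  {p | 0 < p.1 ∧ a p.1 < p.2 ∧ p.2 < b p.1}

/-- `Ω̃ = ⋃_{t > 0} {t} × [a(t), b(t)]`. -/
def lateralDomain (a b : ℝ → ℝ) : Set (ℝ × ℝ) :=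
  {p | 0 < p.1 ∧ a p.1 ≤ p.2 ∧ p.2 ≤ b p.1}

/-- `Ω̄ = ⋃_{t ≥ 0} {t} × [a(t), b(t)]`, the closure of `Ω`. -/
def closedDomain (a b : ℝ → ℝ) : Set (ℝ × ℝ) :=
  {p | 0 ≤ p.1 ∧ a p.1 ≤ p.2 ∧ p.2 ≤ b p.1}

/-- Classical solutions of the two-piston system with input `u` and external pressure `Pext`,
normalized to total mass one. The functions `ρ`, `v` (time first, then position) are total,
but only their values on the closed domain are constrained or used. -/
structure IsClassicalSolution (P μ : ℝ → ℝ) (Pext : ℝ) (u a b : ℝ → ℝ) (ρ v : ℝ → ℝ → ℝ) :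
    Prop where
  continuous_u : ContinuousOn u (Ici 0)
  a_C1 : ContDiffOn ℝ 1 a (Ici 0)
  a_C2 : ContDiffOn ℝ 2 a (Ioi 0)
  b_C1 : ContDiffOn ℝ 1 b (Ici 0)
  b_C2 : ContDiffOn ℝ 2 b (Ioi 0)
  a_lt_b : ∀ t, 0 ≤ t → a t < b t
  ρ_pos : ∀ t x, 0 ≤ t → x ∈ Icc (a t) (b t) → 0 < ρ t x
  ρ_C1 : C1UpTo (openDomain a b) (closedDomain a b) (Function.uncurry ρ)
  ρ_C2 : ContDiffOn ℝ 2 (Function.uncurry ρ) (openDomain a b)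
  v_C0 : ContinuousOn (Function.uncurry v) (closedDomain a b)
  v_C1 : C1UpTo (openDomain a b) (lateralDomain a b) (Function.uncurry v)
  v_C2 : ∀ t, 0 < t → ContDiffOn ℝ 2 (v t) (Ioo (a t) (b t))
  /-- Conservation of mass. At the end points of `[a(t), b(t)]` it follows by continuity for
  the continuous extensions of the derivatives. -/
  mass : ∀ t x, 0 < t → x ∈ Ioo (a t) (b t) →
    deriv (fun s => ρ s x) t + deriv (fun y => ρ t y * v t y) x = 0
  /-- Conservation of momentum. -/
  momentum : ∀ t x, 0 < t → x ∈ Ioo (a t) (b t) →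
    ρ t x * deriv (fun s => v s x) t + ρ t x * v t x * deriv (v t) x =
      deriv (fun y => μ (ρ t y) * deriv (v t) y - P (ρ t y)) x
  /-- The pistons move with the gas (one-sided derivatives at `t = 0`). -/
  velocity_a : ∀ t, 0 ≤ t → HasDerivWithinAt a (v t (a t)) (Ici 0) t
  velocity_b : ∀ t, 0 ≤ t → HasDerivWithinAt b (v t (b t)) (Ici 0) t
  /-- Newton's law for the right piston; `v_x` at the end point is one-sided. -/
  newton_b : ∀ t, 0 < t → deriv (deriv b) t =
    P (ρ t (b t)) - μ (ρ t (b t)) * derivWithin (v t) (Icc (a t) (b t)) (b t) - Pext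
  /-- Newton's law for the left, actuated piston. -/
  newton_a : ∀ t, 0 < t → deriv (deriv a) t =
    u t + Pext - P (ρ t (a t)) + μ (ρ t (a t)) * derivWithin (v t) (Icc (a t) (b t)) (a t)
  /-- The total mass is one. -/
  total_mass : ∀ t, 0 ≤ t → ∫ x in (a t)..(b t), ρ t x = 1

/-- Potential energy. -/
def U (P : ℝ → ℝ) (ρs a b : ℝ) (ρ : ℝ → ℝ) : ℝ := ∫ x in a..b, Q P ρs (ρ x)

/-- Total mechanical energy. -/
def E (P : ℝ → ℝ) (ρs a b : ℝ) (ρ v : ℝ → ℝ) : ℝ :=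
  v a ^ 2 / 2 + v b ^ 2 / 2 + (1 / 2) * (∫ x in a..b, ρ x * v x ^ 2) + U P ρs a b ρ

/-- The functional `W`. -/
def W (P μ : ℝ → ℝ) (ρs a b : ℝ) (ρ v : ℝ → ℝ) : ℝ :=
  (1 / 2) * (∫ x in a..b, 1 / ρ x * (ρ x * v x + deriv (fun y => k μ ρs (ρ y)) x) ^ 2)
    + (1 / 2) * (v b - k μ ρs (ρ b)) ^ 2 + (1 / 2) * (v a + k μ ρs (ρ a)) ^ 2 + U P ρs a b ρ

/-- The control Lyapunov functional `V = W + r E`. -/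
def V (P μ : ℝ → ℝ) (ρs r a b : ℝ) (ρ v : ℝ → ℝ) : ℝ :=
  W P μ ρs a b ρ v + r * E P ρs a b ρ v

/-- `Φ(a, b, ρ, v) = (ρ̃, ṽ)`: the profiles rescaled to the unit interval. -/
def Phi (a b : ℝ) (ρ v : ℝ → ℝ) : (ℝ → ℝ) × (ℝ → ℝ) :=
  (fun θ => ρ (a + (b - a) * θ), fun θ => v (a + (b - a) * θ))

/-- The norm of the state space `H¹(0,1) × C⁰([0,1])`:
`√(v(0)² + v(1)²) + ‖v‖₂ + max_{[0,1]} |ρ| + ‖ρ'‖₂`. -/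
def stateNorm (p : (ℝ → ℝ) × (ℝ → ℝ)) : ℝ :=
  √(p.2 0 ^ 2 + p.2 1 ^ 2) + √(∫ θ in (0 : ℝ)..1, p.2 θ ^ 2)
    + sSup ((fun θ => |p.1 θ|) '' Icc 0 1) + √(∫ θ in (0 : ℝ)..1, deriv p.1 θ ^ 2)

/-- The equilibrium `(ρ* χ_{[0,1]}, 0)`, as functions on the unit interval. -/
def equilibrium (ρs : ℝ) : (ℝ → ℝ) × (ℝ → ℝ) := (fun _ => ρs, fun _ => 0)

end TwoPiston

end

/-! With $r=RK/2$ the functional $V=W+rE$ is a strict Lyapunov functional of the closed loop. As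
long as the density stays in a fixed compact subset of $(0,\infty)$, it is equivalent to the square
of the state norm.

Two balances drive the proof. By `hasDerivAt_E` the energy is lost only through viscosity and the
feedback. The functional $W$ is an energy in which $v$ is replaced by the effective velocity
$w=v+\mu(\rho)\rho_x/\rho^2$. Differentiating the mass equation in $x$ removes the viscous term from
the equation for $w$, so $w$ is accelerated by the pressure gradient alone. Likewise
$v(b)-k(\rho(b))$ and $v(a)+k(\rho(a))$ obey Newton's laws without viscous stress. Hence
`hasDerivAt_W` shows dissipation of the density gradient and of the boundary densities. Under
$u=-Rv(a)$ the only term of indefinite sign is $-Rv(a)k(\rho(a))$. Since (A) gives $k^2\le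
K\,k\,(P-P(\rho^*))$, completing the square absorbs it (`exists_hasDerivAt_V_le`).

The signs alone make $V$ nonincreasing, so $W$ and $E$ stay bounded. These bounds control the
oscillation of $G(\rho)$ and the value $k(\rho(b))$, and unit mass together with the potential
energy excludes a density that is small everywhere. By (H) the density is then confined to some
$[m,M]$ (`exists_density_bounds`).

On $[m,M]$ all constitutive functions are comparable to powers of $\rho-\rho^*$. One-dimensional
Sobolev and Poincaré inequalities then make $V$, `deviation` and the squared state norm equivalent
and bound them by the dissipation (`deviation_le_dissipation`). Exponential decay follows by
Gronwall. A larger $r$ only increases $V$, so the constants need not depend on $r$. -/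

noncomputable section

namespace TwoPiston

open MeasureTheory Filter Topology

/-! ### Calculus on moving domains: stretched coordinates and Reynolds' theorem. -/

/-- The part over the times in `I` of the region between the curves `a` and `b`. -/
def strip (I : Set ℝ) (a b : ℝ → ℝ) : Set (ℝ × ℝ) :=
  {p | p.1 ∈ I ∧ a p.1 ≤ p.2 ∧ p.2 ≤ b p.1}

/-- The affine parametrization of the region between `a` and `b` by a strip of width one. -/
def stretch (a b : ℝ → ℝ) (p : ℝ × ℝ) : ℝ × ℝ := (p.1, a p.1 + (b p.1 - a p.1) * p.2)

lemma lateralDomain_subset_closedDomain (a b : ℝ → ℝ) : lateralDomain a b ⊆ closedDomain a b :=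
  fun _ hp => ⟨le_of_lt hp.1, hp.2⟩

lemma openDomain_subset_lateralDomain (a b : ℝ → ℝ) : openDomain a b ⊆ lateralDomain a b :=
  fun _ hp => ⟨hp.1, hp.2.1.le, hp.2.2.le⟩

lemma stretch_mem_strip {I : Set ℝ} {a b : ℝ → ℝ} (hab : ∀ t ∈ I, a t ≤ b t) {p : ℝ × ℝ}
    (hp : p ∈ I ×ˢ Icc (0 : ℝ) 1) : stretch a b p ∈ strip I a b := by
  obtain ⟨h1, h2, h3⟩ := hp
  have := hab _ h1
  refine ⟨h1, ?_, ?_⟩ <;> simp only [stretch] <;> nlinarith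

lemma continuousOn_stretch {I : Set ℝ} {a b : ℝ → ℝ} (ha : ContinuousOn a I)
    (hb : ContinuousOn b I) : ContinuousOn (stretch a b) (I ×ˢ Icc (0 : ℝ) 1) := by
  have ha' : ContinuousOn (fun p : ℝ × ℝ => a p.1) (I ×ˢ Icc (0 : ℝ) 1) :=
    ha.comp continuousOn_fst fun p hp => hp.1
  have hb' : ContinuousOn (fun p : ℝ × ℝ => b p.1) (I ×ˢ Icc (0 : ℝ) 1) :=
    hb.comp continuousOn_fst fun p hp => hp.1
  exact continuousOn_fst.prodMk (ha'.add ((hb'.sub ha').mul continuousOn_snd))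

lemma continuousOn_comp_stretch {E : Type*} [TopologicalSpace E] {I : Set ℝ} {a b : ℝ → ℝ}
    (ha : ContinuousOn a I)
    (hb : ContinuousOn b I) (hab : ∀ t ∈ I, a t ≤ b t) {f : ℝ × ℝ → E}
    (hf : ContinuousOn f (strip I a b)) :
    ContinuousOn (fun p => f (stretch a b p)) (I ×ˢ Icc (0 : ℝ) 1) :=
  hf.comp (continuousOn_stretch ha hb) fun _ hp => stretch_mem_strip hab hp

lemma continuousOn_parametric_integral {I : Set ℝ} {F : ℝ × ℝ → ℝ}
    (hF : ContinuousOn F (I ×ˢ Icc (0 : ℝ) 1)) :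
    ContinuousOn (fun t => ∫ θ in (0 : ℝ)..1, F (t, θ)) I := by
  rw [continuousOn_iff_continuous_domRestrict]
  -- Projecting $\theta$ onto $[0,1]$ extends the integrand continuously to all real $\theta$
  -- without changing the integral.
  have h : Continuous (Function.uncurry fun (t : I) (θ : ℝ) =>
      F (t, projIcc (0 : ℝ) 1 zero_le_one θ)) := by
    refine hF.comp_continuous ?_ ?_
    · exact (continuous_subtype_val.comp continuous_fst).prodMk
        (continuous_subtype_val.comp (continuous_projIcc.comp continuous_snd))
    · intro p
      exact ⟨p.1.2, (projIcc (0 : ℝ) 1 zero_le_one p.2).2⟩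
  have h2 := intervalIntegral.continuous_parametric_intervalIntegral_of_continuous'
    (μ := volume) h 0 1
  refine h2.congr fun t => ?_
  refine intervalIntegral.integral_congr fun θ hθ => ?_
  rw [uIcc_of_le zero_le_one] at hθ
  simp only [projIcc_of_mem zero_le_one hθ]

lemma integral_eq_integral_stretch (a b : ℝ) (f : ℝ → ℝ) :
    ∫ x in a..b, f x = ∫ θ in (0 : ℝ)..1, (b - a) * f (a + (b - a) * θ) := by
  rw [intervalIntegral.integral_const_mul, ← smul_eq_mul,
    intervalIntegral.smul_integral_comp_add_mul]
  simp

lemma continuousOn_integral_strip {I : Set ℝ} {a b : ℝ → ℝ} (ha : ContinuousOn a I)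
    (hb : ContinuousOn b I) (hab : ∀ t ∈ I, a t ≤ b t) {f : ℝ × ℝ → ℝ}
    (hf : ContinuousOn f (strip I a b)) :
    ContinuousOn (fun t => ∫ x in (a t)..(b t), f (t, x)) I := by
  have h := continuousOn_comp_stretch ha hb hab hf
  have ha' : ContinuousOn (fun p : ℝ × ℝ => a p.1) (I ×ˢ Icc (0 : ℝ) 1) :=
    ha.comp continuousOn_fst fun p hp => hp.1
  have hb' : ContinuousOn (fun p : ℝ × ℝ => b p.1) (I ×ˢ Icc (0 : ℝ) 1) :=
    hb.comp continuousOn_fst fun p hp => hp.1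
  refine (continuousOn_parametric_integral ((hb'.sub ha').mul h)).congr fun t _ => ?_
  exact integral_eq_integral_stretch (a t) (b t) fun x => f (t, x)

/-- Green's formula on a strip for a flux that vanishes on the lateral boundary. -/
lemma integral_sub_integral_of_divergence {F J G : ℝ × ℝ → ℝ} {s t : ℝ} (hst : s ≤ t)
    (hF : ContinuousOn F (Icc s t ×ˢ Icc (0 : ℝ) 1))
    (hJ : ContinuousOn J (Icc s t ×ˢ Icc (0 : ℝ) 1))
    (hG : ContinuousOn G (Icc s t ×ˢ Icc (0 : ℝ) 1))
    (hdiv : ∀ p ∈ Ioo s t ×ˢ Ioo (0 : ℝ) 1, ∃ F' J' : ℝ × ℝ →L[ℝ] ℝ,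
      HasFDerivAt F F' p ∧ HasFDerivAt J J' p ∧ F' (1, 0) + J' (0, 1) = G p)
    (hJ0 : ∀ τ ∈ Icc s t, J (τ, 0) = 0) (hJ1 : ∀ τ ∈ Icc s t, J (τ, 1) = 0) :
    (∫ θ in (0 : ℝ)..1, F (t, θ)) - ∫ θ in (0 : ℝ)..1, F (s, θ)
      = ∫ τ in s..t, ∫ θ in (0 : ℝ)..1, G (τ, θ) := by
  classical
  -- The divergence theorem takes derivatives as total functions and integrates their divergence
  -- over the closed rectangle. Off the open rectangle they are chosen so that the divergence still
  -- equals `G`, which makes the integrand exactly `G`.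
  have key : ∀ p : ℝ × ℝ, ∃ L : (ℝ × ℝ →L[ℝ] ℝ) × (ℝ × ℝ →L[ℝ] ℝ),
      L.1 (1, 0) + L.2 (0, 1) = G p ∧
      (p ∈ Ioo s t ×ˢ Ioo (0 : ℝ) 1 → HasFDerivAt F L.1 p ∧ HasFDerivAt J L.2 p) := by
    intro p
    by_cases hp : p ∈ Ioo s t ×ˢ Ioo (0 : ℝ) 1
    · obtain ⟨F', J', h1, h2, h3⟩ := hdiv p hp
      exact ⟨(F', J'), h3, fun _ => ⟨h1, h2⟩⟩
    · exact ⟨(G p • ContinuousLinearMap.fst ℝ ℝ ℝ, 0), by simp, fun h => absurd h hp⟩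
  choose L hL1 hL2 using key
  have h := integral2_divergence_prod_of_hasFDerivAt_off_countable F J (fun p => (L p).1)
    (fun p => (L p).2) s 0 t 1 ∅ countable_empty
    (by rwa [uIcc_of_le hst, uIcc_of_le zero_le_one])
    (by rwa [uIcc_of_le hst, uIcc_of_le zero_le_one])
    (by
      rw [min_eq_left hst, max_eq_right hst, min_eq_left zero_le_one, max_eq_right zero_le_one]
      exact fun p hp => (hL2 p hp.1).1)
    (by
      rw [min_eq_left hst, max_eq_right hst, min_eq_left zero_le_one, max_eq_right zero_le_one]
      exact fun p hp => (hL2 p hp.1).2)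
    (by
      rw [uIcc_of_le hst, uIcc_of_le zero_le_one]
      simp only [hL1]
      exact hG.integrableOn_compact (isCompact_Icc.prod isCompact_Icc))
  simp only [hL1] at h
  rw [h]
  have e0 : ∫ x in s..t, J (x, 0) = 0 := by
    rw [intervalIntegral.integral_congr (g := fun _ => 0)]
    · simp
    · intro τ hτ; rw [uIcc_of_le hst] at hτ; exact hJ0 τ hτ
  have e1 : ∫ x in s..t, J (x, 1) = 0 := by
    rw [intervalIntegral.integral_congr (g := fun _ => 0)]
    · simp
    · intro τ hτ; rw [uIcc_of_le hst] at hτ; exact hJ1 τ hτ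
  rw [e0, e1]; ring

lemma apply_pair (L : ℝ × ℝ →L[ℝ] ℝ) (x y : ℝ) : L (x, y) = x * L (1, 0) + y * L (0, 1) := by
  rw [← smul_eq_mul, ← smul_eq_mul, ← map_smul, ← map_smul, ← map_add]; simp

lemma hasFDerivAt_stretch {a b : ℝ → ℝ} {p : ℝ × ℝ} {a' b' : ℝ} (ha : HasDerivAt a a' p.1)
    (hb : HasDerivAt b b' p.1) :
    HasFDerivAt (stretch a b) ((ContinuousLinearMap.fst ℝ ℝ ℝ).prod
      ((a' + (b' - a') * p.2) • ContinuousLinearMap.fst ℝ ℝ ℝ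
        + (b p.1 - a p.1) • ContinuousLinearMap.snd ℝ ℝ ℝ)) p := by
  have h1 : HasFDerivAt (fun q : ℝ × ℝ => a q.1) (a' • ContinuousLinearMap.fst ℝ ℝ ℝ) p :=
    ha.comp_hasFDerivAt p hasFDerivAt_fst
  have h2 : HasFDerivAt (fun q : ℝ × ℝ => b q.1) (b' • ContinuousLinearMap.fst ℝ ℝ ℝ) p :=
    hb.comp_hasFDerivAt p hasFDerivAt_fst
  refine HasFDerivAt.prodMk hasFDerivAt_fst ?_
  refine (h1.add ((h2.sub h1).mul hasFDerivAt_snd)).congr_fderiv ?_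
  ext <;> simp; ring

lemma stretch_mem_openDomain {a b : ℝ → ℝ} {p : ℝ × ℝ} (hp : p ∈ Ioi (0 : ℝ) ×ˢ Ioo (0 : ℝ) 1)
    (hab : a p.1 < b p.1) : stretch a b p ∈ openDomain a b := by
  obtain ⟨h1, h2, h3⟩ := hp
  refine ⟨h1, ?_, ?_⟩ <;> simp only [stretch] <;> nlinarith

/-- **Reynolds' transport theorem** between two material curves `a` and `b`. The integrand
need only be differentiable in the interior as long as its rate of change is continuous up to the
lateral boundary. -/
theorem hasDerivAt_integral_of_transport {a b : ℝ → ℝ} {v f g : ℝ × ℝ → ℝ}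
    (ha : ContDiffOn ℝ 2 a (Ioi 0)) (hb : ContDiffOn ℝ 2 b (Ioi 0))
    (hab : ∀ t, 0 < t → a t < b t)
    (hva : ∀ t, 0 < t → deriv a t = v (t, a t)) (hvb : ∀ t, 0 < t → deriv b t = v (t, b t))
    (hv : ContinuousOn v (lateralDomain a b)) (hf : ContinuousOn f (lateralDomain a b))
    (hg : ContinuousOn g (lateralDomain a b))
    (hdiv : ∀ p ∈ openDomain a b, ∃ f' v' : ℝ × ℝ →L[ℝ] ℝ, HasFDerivAt f f' p ∧
      HasFDerivAt v v' p ∧ f' (1, 0) + f' (0, 1) * v p + f p * v' (0, 1) = g p)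
    {t : ℝ} (ht : 0 < t) :
    HasDerivAt (fun t => ∫ x in (a t)..(b t), f (t, x)) (∫ x in (a t)..(b t), g (t, x)) t := by
  have hab' : ∀ t ∈ Ioi (0 : ℝ), a t ≤ b t := fun t ht => (hab t ht).le
  have hda : ∀ t ∈ Ioi (0 : ℝ), HasDerivAt a (deriv a t) t := fun t ht =>
    ((ha.contDiffAt (Ioi_mem_nhds ht)).differentiableAt (by norm_num)).hasDerivAt
  have hdb : ∀ t ∈ Ioi (0 : ℝ), HasDerivAt b (deriv b t) t := fun t ht =>
    ((hb.contDiffAt (Ioi_mem_nhds ht)).differentiableAt (by norm_num)).hasDerivAt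
  have hda1 : ContDiffOn ℝ 1 (deriv a) (Ioi 0) := ha.deriv_of_isOpen isOpen_Ioi (by norm_num)
  have hdb1 : ContDiffOn ℝ 1 (deriv b) (Ioi 0) := hb.deriv_of_isOpen isOpen_Ioi (by norm_num)
  have hdda : ∀ t ∈ Ioi (0 : ℝ), HasDerivAt (deriv a) (deriv (deriv a) t) t := fun t ht =>
    ((hda1.contDiffAt (Ioi_mem_nhds ht)).differentiableAt (by norm_num)).hasDerivAt
  have hddb : ∀ t ∈ Ioi (0 : ℝ), HasDerivAt (deriv b) (deriv (deriv b) t) t := fun t ht =>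
    ((hdb1.contDiffAt (Ioi_mem_nhds ht)).differentiableAt (by norm_num)).hasDerivAt
  have cl : ∀ {h : ℝ → ℝ}, ContinuousOn h (Ioi 0) →
      ContinuousOn (fun p : ℝ × ℝ => h p.1) (Ioi (0 : ℝ) ×ˢ Icc (0 : ℝ) 1) := fun hh =>
    hh.comp continuousOn_fst fun p hp => hp.1
  have ca := ha.continuousOn
  have cb := hb.continuousOn
  have cf := continuousOn_comp_stretch ca cb hab' hf
  have cv := continuousOn_comp_stretch ca cb hab' hv
  have cg := continuousOn_comp_stretch ca cb hab' hg
  have cF := ((cl cb).sub (cl ca)).mul cf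
  have cG := ((cl cb).sub (cl ca)).mul cg
  -- The flux in stretched coordinates is $f$ times the velocity relative to the moving grid. It
  -- vanishes at $\theta=0,1$ because $a$ and $b$ are material curves.
  have cJ := cf.mul (cv.sub ((cl hda1.continuousOn).add
    (((cl hdb1.continuousOn).sub (cl hda1.continuousOn)).mul continuousOn_snd)))
  have key : ∀ s t : ℝ, 0 < s → s ≤ t → (∫ x in (a t)..(b t), f (t, x))
      - (∫ x in (a s)..(b s), f (s, x)) = ∫ τ in s..t, ∫ x in (a τ)..(b τ), g (τ, x) := by
    intro s t hs hst
    have hsub : Icc s t ×ˢ Icc (0 : ℝ) 1 ⊆ Ioi (0 : ℝ) ×ˢ Icc (0 : ℝ) 1 :=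
      prod_mono (fun x hx => lt_of_lt_of_le hs hx.1) Subset.rfl
    have := integral_sub_integral_of_divergence hst (cF.mono hsub) (cJ.mono hsub) (cG.mono hsub)
      ?_ ?_ ?_
    · simp only [Pi.mul_apply, Pi.sub_apply] at this
      rw [integral_eq_integral_stretch (a t) (b t) fun x => f (t, x),
        integral_eq_integral_stretch (a s) (b s) fun x => f (s, x)]
      simp only [integral_eq_integral_stretch (a _) (b _) fun x => g (_, x)]
      exact this
    · intro p hp
      have hp0 : p.1 ∈ Ioi (0 : ℝ) := lt_trans hs hp.1.1
      have hmem : stretch a b p ∈ openDomain a b :=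
        stretch_mem_openDomain ⟨hp0, hp.2⟩ (hab _ hp0)
      obtain ⟨f', v', h1, h2, h3⟩ := hdiv _ hmem
      have hs := hasFDerivAt_stretch (hda _ hp0) (hdb _ hp0)
      have k1 := h1.comp p hs
      have k2 := h2.comp p hs
      have l1 : ∀ {h : ℝ → ℝ} {h' : ℝ}, HasDerivAt h h' p.1 →
          HasFDerivAt (fun q : ℝ × ℝ => h q.1) (h' • ContinuousLinearMap.fst ℝ ℝ ℝ) p :=
        fun hh => hh.comp_hasFDerivAt p hasFDerivAt_fst
      refine ⟨_, _, ((l1 (hdb _ hp0)).sub (l1 (hda _ hp0))).mul k1,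
        k1.mul (k2.sub ((l1 (hdda _ hp0)).add
          (((l1 (hddb _ hp0)).sub (l1 (hdda _ hp0))).mul hasFDerivAt_snd))), ?_⟩
      have e1 := apply_pair f' 1 (deriv a p.1 + (deriv b p.1 - deriv a p.1) * p.2)
      have e2 := apply_pair f' 0 (b p.1 - a p.1)
      have e3 := apply_pair v' 0 (b p.1 - a p.1)
      simp only [Pi.mul_apply, Pi.sub_apply, ← h3]
      simp [e1, e2, e3]
      ring
    · intro τ hτ
      have hτ0 : 0 < τ := lt_of_lt_of_le hs hτ.1
      simp [stretch, hva τ hτ0]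
    · intro τ hτ
      have hτ0 : 0 < τ := lt_of_lt_of_le hs hτ.1
      simp [stretch, hvb τ hτ0]
  have cI : ContinuousOn (fun τ => ∫ x in (a τ)..(b τ), g (τ, x)) (Ioi 0) :=
    continuousOn_integral_strip ca cb hab' hg
  -- Integrating from $t/2$ keeps the time interval inside $(0,\infty)$, where the data are regular.
  have ht2 : 0 < t / 2 := by linarith
  have hint : IntervalIntegrable (fun τ => ∫ x in (a τ)..(b τ), g (τ, x)) volume (t / 2) t := by
    refine (cI.mono ?_).intervalIntegrable
    rw [uIcc_of_le (by linarith)]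
    exact fun x hx => lt_of_lt_of_le ht2 hx.1
  have hd := intervalIntegral.integral_hasDerivAt_right hint
    (cI.stronglyMeasurableAtFilter isOpen_Ioi t ht) (cI.continuousAt (Ioi_mem_nhds ht))
  refine (hd.add_const (∫ x in (a (t / 2))..(b (t / 2)), f (t / 2, x))).congr_of_eventuallyEq ?_
  filter_upwards [Ioi_mem_nhds (show t / 2 < t by linarith)] with τ hτ
  have := key (t / 2) τ ht2 (le_of_lt hτ)
  linarith

/-! ### Derivatives along slices, up to the boundary and at the initial time. -/

lemma hasDerivAt_slice {f : ℝ × ℝ → ℝ} {L : ℝ × ℝ →L[ℝ] ℝ} {p : ℝ × ℝ} (h : HasFDerivAt f L p) :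
    HasDerivAt (fun y => f (p.1, y)) (L (0, 1)) p.2 :=
  HasFDerivAt.comp_hasDerivAt (f := fun y => (p.1, y)) p.2 h
    ((hasDerivAt_const _ _).prodMk (hasDerivAt_id _))

lemma hasDerivAt_slice_left {f : ℝ × ℝ → ℝ} {L : ℝ × ℝ →L[ℝ] ℝ} {p : ℝ × ℝ}
    (h : HasFDerivAt f L p) : HasDerivAt (fun s => f (s, p.2)) (L (1, 0)) p.1 :=
  HasFDerivAt.comp_hasDerivAt (f := fun s => (s, p.2)) p.1 h
    ((hasDerivAt_id _).prodMk (hasDerivAt_const _ _))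

/-- A `C¹` function on a moving domain is differentiable along the curves of constant relative
position, including the boundary curves. -/
lemma hasDerivAt_comp_stretch {a b : ℝ → ℝ} {f : ℝ × ℝ → ℝ} {g : ℝ × ℝ → (ℝ × ℝ →L[ℝ] ℝ)}
    (ha : ContDiffOn ℝ 1 a (Ioi 0)) (hb : ContDiffOn ℝ 1 b (Ioi 0))
    (hab : ∀ t, 0 < t → a t < b t)
    (hf : ContinuousOn f (lateralDomain a b)) (hg : ContinuousOn g (lateralDomain a b))
    (hfg : ∀ p ∈ openDomain a b, HasFDerivAt f (g p) p) {t θ : ℝ} (ht : 0 < t)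
    (hθ : θ ∈ Icc (0 : ℝ) 1) :
    HasDerivAt (fun s => f (stretch a b (s, θ)))
      (g (stretch a b (t, θ)) (1, deriv a t + (deriv b t - deriv a t) * θ)) t := by
  have hab' : ∀ t ∈ Ioi (0 : ℝ), a t ≤ b t := fun t ht => (hab t ht).le
  have hda : ∀ t ∈ Ioi (0 : ℝ), HasDerivAt a (deriv a t) t := fun t ht =>
    ((ha.contDiffAt (Ioi_mem_nhds ht)).differentiableAt (by norm_num)).hasDerivAt
  have hdb : ∀ t ∈ Ioi (0 : ℝ), HasDerivAt b (deriv b t) t := fun t ht =>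
    ((hb.contDiffAt (Ioi_mem_nhds ht)).differentiableAt (by norm_num)).hasDerivAt
  have cl : ∀ {h : ℝ → ℝ}, ContinuousOn h (Ioi 0) →
      ContinuousOn (fun p : ℝ × ℝ => h p.1) (Ioi (0 : ℝ) ×ˢ Icc (0 : ℝ) 1) := fun hh =>
    hh.comp continuousOn_fst fun p hp => hp.1
  have ca := cl ha.continuousOn
  have cb := cl hb.continuousOn
  have ca1 := cl (ha.continuousOn_deriv_of_isOpen isOpen_Ioi le_rfl)
  have cb1 := cl (hb.continuousOn_deriv_of_isOpen isOpen_Ioi le_rfl)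
  have cf := continuousOn_comp_stretch ha.continuousOn hb.continuousOn hab' hf
  have cg := continuousOn_comp_stretch ha.continuousOn hb.continuousOn hab' hg
  set D : ℝ × ℝ → (ℝ × ℝ →L[ℝ] ℝ × ℝ) := fun p => (ContinuousLinearMap.fst ℝ ℝ ℝ).prod
    ((deriv a p.1 + (deriv b p.1 - deriv a p.1) * p.2) • ContinuousLinearMap.fst ℝ ℝ ℝ
        + (b p.1 - a p.1) • ContinuousLinearMap.snd ℝ ℝ ℝ) with hD
  have cD : ContinuousOn D (Ioi (0 : ℝ) ×ˢ Icc (0 : ℝ) 1) := by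
    -- A combination of constant operators with continuous scalar coefficients, so continuity is
    -- visible.
    have : D = fun p => (ContinuousLinearMap.inl ℝ ℝ ℝ).comp (ContinuousLinearMap.fst ℝ ℝ ℝ) +
        ((deriv a p.1 + (deriv b p.1 - deriv a p.1) * p.2) •
          (ContinuousLinearMap.inr ℝ ℝ ℝ).comp (ContinuousLinearMap.fst ℝ ℝ ℝ) +
        (b p.1 - a p.1) • (ContinuousLinearMap.inr ℝ ℝ ℝ).comp
          (ContinuousLinearMap.snd ℝ ℝ ℝ)) := by
      funext p
      ext <;> simp [hD]
    rw [this]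
    exact continuousOn_const.add ((((ca1.add ((cb1.sub ca1).mul continuousOn_snd)).smul
      continuousOn_const)).add ((cb.sub ca).smul continuousOn_const))
  have cL : ContinuousOn (fun p => (g (stretch a b p)).comp (D p))
      (Ioi (0 : ℝ) ×ˢ Icc (0 : ℝ) 1) := cg.clm_comp cD
  -- A convex open box whose closure reaches $\theta=0$ and $\theta=1$. The derivative extends
  -- continuously to the closure, and $t$ is interior in time, so the derivative obtained at $t$ is
  -- two-sided.
  set s : Set (ℝ × ℝ) := Ioo (t / 2) (2 * t) ×ˢ Ioo (0 : ℝ) 1 with hs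
  have hsI : s ⊆ Ioi (0 : ℝ) ×ˢ Ioo (0 : ℝ) 1 :=
    prod_mono (fun x hx => lt_trans (by linarith) hx.1) Subset.rfl
  have hsI' : s ⊆ Ioi (0 : ℝ) ×ˢ Icc (0 : ℝ) 1 :=
    hsI.trans (prod_mono Subset.rfl Ioo_subset_Icc_self)
  have hcl : closure s = Icc (t / 2) (2 * t) ×ˢ Icc (0 : ℝ) 1 := by
    rw [hs, closure_prod_eq, closure_Ioo (by linarith), closure_Ioo (by norm_num)]
  have hclI : closure s ⊆ Ioi (0 : ℝ) ×ˢ Icc (0 : ℝ) 1 := by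
    rw [hcl]
    exact prod_mono (fun x hx => lt_of_lt_of_le (by linarith) hx.1) Subset.rfl
  have hfd : ∀ p ∈ s, HasFDerivAt (fun p => f (stretch a b p))
      ((g (stretch a b p)).comp (D p)) p := by
    intro p hp
    have hp0 : p.1 ∈ Ioi (0 : ℝ) := (hsI hp).1
    exact (hfg _ (stretch_mem_openDomain (hsI hp) (hab _ hp0))).comp p
      (hasFDerivAt_stretch (hda _ hp0) (hdb _ hp0))
  have hpt : ((t, θ) : ℝ × ℝ) ∈ Ioi (0 : ℝ) ×ˢ Icc (0 : ℝ) 1 := ⟨ht, hθ⟩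
  have h := hasFDerivWithinAt_closure_of_tendsto_fderiv (x := ((t, θ) : ℝ × ℝ))
    (f := fun p => f (stretch a b p)) (f' := (g (stretch a b (t, θ))).comp (D (t, θ)))
    (s := s) (fun p hp => (hfd p hp).differentiableAt.differentiableWithinAt)
    ((convex_Ioo _ _).prod (convex_Ioo _ _)) (isOpen_Ioo.prod isOpen_Ioo)
    (fun y hy => (cf y (hclI hy)).mono hsI')
    (((cL _ hpt).mono hsI').congr' (by
      filter_upwards [self_mem_nhdsWithin] with p hp
      exact (hfd p hp).fderiv.symm))
  rw [hcl] at h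
  have h2 := h.comp_hasDerivWithinAt (f := fun s => (s, θ)) (s := Icc (t / 2) (2 * t)) t
    ((hasDerivWithinAt_id _ _).prodMk (hasDerivWithinAt_const _ _ _))
    (fun x hx => ⟨hx, hθ⟩)
  have h3 := h2.hasDerivAt (Icc_mem_nhds (by linarith) (by linarith))
  exact h3.congr_deriv (by simp [hD])

/-- A `C¹` function on a moving domain is differentiable in space at the initial time. -/
lemma hasDerivAt_initial {a b : ℝ → ℝ} {f : ℝ × ℝ → ℝ} {g : ℝ × ℝ → (ℝ × ℝ →L[ℝ] ℝ)}
    (ha : ContinuousOn a (Ici 0)) (hb : ContinuousOn b (Ici 0))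
    (hf : ContinuousOn f (closedDomain a b)) (hg : ContinuousOn g (closedDomain a b))
    (hfg : ∀ p ∈ openDomain a b, HasFDerivAt f (g p) p) {x : ℝ} (hx : x ∈ Ioo (a 0) (b 0)) :
    HasDerivAt (fun y => f (0, y)) (g (0, x) (0, 1)) x := by
  obtain ⟨hx1, hx2⟩ := hx
  -- The midpoints leave room for a rectangle $[0,\varepsilon]\times[y_1,y_2]$ inside the moving
  -- domain.
  set y1 := (a 0 + x) / 2 with hy1
  set y2 := (x + b 0) / 2 with hy2
  have e1 : ∀ᶠ s in 𝓝[Ici 0] (0 : ℝ), a s < y1 :=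
    (ha 0 self_mem_Ici).eventually (gt_mem_nhds (by linarith))
  have e2 : ∀ᶠ s in 𝓝[Ici 0] (0 : ℝ), y2 < b s :=
    (hb 0 self_mem_Ici).eventually (lt_mem_nhds (by linarith))
  obtain ⟨ε, hε, hsub⟩ := (mem_nhdsGE_iff_exists_Icc_subset).1 (e1.and e2)
  have hε : 0 < ε := hε
  set s : Set (ℝ × ℝ) := Ioo 0 ε ×ˢ Ioo y1 y2 with hs
  have hcl : closure s = Icc 0 ε ×ˢ Icc y1 y2 := by
    rw [hs, closure_prod_eq, closure_Ioo hε.ne, closure_Ioo (by linarith)]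
  have hsO : s ⊆ openDomain a b := fun p hp => by
    have := hsub (Ioo_subset_Icc_self hp.1)
    exact ⟨hp.1.1, lt_trans this.1 hp.2.1, lt_trans hp.2.2 this.2⟩
  have hclC : closure s ⊆ closedDomain a b := fun p hp => by
    rw [hcl] at hp
    have := hsub hp.1
    exact ⟨hp.1.1, le_trans this.1.le hp.2.1, le_trans hp.2.2 this.2.le⟩
  have hsC : s ⊆ closedDomain a b := subset_closure.trans hclC
  have hpt : ((0, x) : ℝ × ℝ) ∈ closedDomain a b := ⟨le_rfl, hx1.le, hx2.le⟩
  have h := hasFDerivWithinAt_closure_of_tendsto_fderiv (x := ((0, x) : ℝ × ℝ))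
    (f := f) (f' := g (0, x)) (s := s)
    (fun p hp => (hfg p (hsO hp)).differentiableAt.differentiableWithinAt)
    ((convex_Ioo _ _).prod (convex_Ioo _ _)) (isOpen_Ioo.prod isOpen_Ioo)
    (fun y hy => (hf y (hclC hy)).mono hsC)
    (((hg _ hpt).mono hsC).congr' (by
      filter_upwards [self_mem_nhdsWithin] with p hp
      exact (hfg p (hsO hp)).fderiv.symm))
  rw [hcl] at h
  have h2 := h.comp_hasDerivWithinAt (f := fun y => ((0 : ℝ), y)) (s := Icc y1 y2) x
    ((hasDerivWithinAt_const _ _ _).prodMk (hasDerivWithinAt_id _ _))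
    (fun y hy => ⟨⟨le_rfl, hε.le⟩, hy⟩)
  exact h2.hasDerivAt (Icc_mem_nhds (by linarith) (by linarith))

/-- A derivative with a limit at an end point is attained there as a one-sided derivative. This
identifies the stress in Newton's law with the continuous extension of $v_x$. -/
lemma derivWithin_Icc_right {f f' : ℝ → ℝ} {x y : ℝ} (hxy : x < y) (hf : ContinuousOn f (Icc x y))
    (hf' : ContinuousOn f' (Icc x y)) (h : ∀ z ∈ Ioo x y, HasDerivAt f (f' z) z) :
    derivWithin f (Icc x y) y = f' y := by
  have hy : y ∈ Icc x y := right_mem_Icc.2 hxy.le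
  have := hasDerivWithinAt_Iic_of_tendsto_deriv (s := Ioo x y) (a := y) (e := f' y)
    (fun z hz => (h z hz).differentiableAt.differentiableWithinAt)
    ((hf y hy).mono Ioo_subset_Icc_self) (Ioo_mem_nhdsLT hxy)
    (((hf' y hy).mono_left (nhdsWithin_le_of_mem (mem_of_superset (Ioo_mem_nhdsLT hxy)
      Ioo_subset_Icc_self))).congr' (by
        filter_upwards [Ioo_mem_nhdsLT hxy] with z hz
        exact (h z hz).deriv.symm))
  exact (this.mono Icc_subset_Iic_self).derivWithin (uniqueDiffOn_Icc hxy y hy)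

lemma derivWithin_Icc_left {f f' : ℝ → ℝ} {x y : ℝ} (hxy : x < y) (hf : ContinuousOn f (Icc x y))
    (hf' : ContinuousOn f' (Icc x y)) (h : ∀ z ∈ Ioo x y, HasDerivAt f (f' z) z) :
    derivWithin f (Icc x y) x = f' x := by
  have hy : x ∈ Icc x y := left_mem_Icc.2 hxy.le
  have := hasDerivWithinAt_Ici_of_tendsto_deriv (s := Ioo x y) (a := x) (e := f' x)
    (fun z hz => (h z hz).differentiableAt.differentiableWithinAt)
    ((hf x hy).mono Ioo_subset_Icc_self) (Ioo_mem_nhdsGT hxy)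
    (((hf' x hy).mono_left (nhdsWithin_le_of_mem (mem_of_superset (Ioo_mem_nhdsGT hxy)
      Ioo_subset_Icc_self))).congr' (by
        filter_upwards [Ioo_mem_nhdsGT hxy] with z hz
        exact (h z hz).deriv.symm))
  exact (this.mono Icc_subset_Ici_self).derivWithin (uniqueDiffOn_Icc hxy x hy)

/-! ### Partial derivatives of a classical solution and the effective velocity. -/

/-- The continuous extensions of the partial derivatives of a classical solution up to the boundary,
together with the differential identities they satisfy. -/
structure HasPartials (P μ : ℝ → ℝ) (Pext : ℝ) (u a b : ℝ → ℝ) (ρ v : ℝ → ℝ → ℝ)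
    (ρt ρx vt vx : ℝ × ℝ → ℝ) : Prop where
  continuousOn_ρt : ContinuousOn ρt (closedDomain a b)
  continuousOn_ρx : ContinuousOn ρx (closedDomain a b)
  continuousOn_vt : ContinuousOn vt (lateralDomain a b)
  continuousOn_vx : ContinuousOn vx (lateralDomain a b)
  hasFDerivAt_ρ : ∀ p ∈ openDomain a b, ∃ L : ℝ × ℝ →L[ℝ] ℝ,
    HasFDerivAt (Function.uncurry ρ) L p ∧ L (1, 0) = ρt p ∧ L (0, 1) = ρx p
  hasFDerivAt_v : ∀ p ∈ openDomain a b, ∃ L : ℝ × ℝ →L[ℝ] ℝ,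
    HasFDerivAt (Function.uncurry v) L p ∧ L (1, 0) = vt p ∧ L (0, 1) = vx p
  hasDerivAt_ρ : ∀ t x, 0 ≤ t → x ∈ Ioo (a t) (b t) → HasDerivAt (ρ t) (ρx (t, x)) x
  mass : ∀ p ∈ lateralDomain a b, ρt p + ρx p * v p.1 p.2 + ρ p.1 p.2 * vx p = 0
  hasDerivAt_ρ_a : ∀ t, 0 < t →
    HasDerivAt (fun s => ρ s (a s)) (-(ρ t (a t) * vx (t, a t))) t
  hasDerivAt_ρ_b : ∀ t, 0 < t →
    HasDerivAt (fun s => ρ s (b s)) (-(ρ t (b t) * vx (t, b t))) t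
  hasDerivAt_v_a : ∀ t, 0 < t → HasDerivAt (fun s => v s (a s))
    (u t + Pext - P (ρ t (a t)) + μ (ρ t (a t)) * vx (t, a t)) t
  hasDerivAt_v_b : ∀ t, 0 < t → HasDerivAt (fun s => v s (b s))
    (P (ρ t (b t)) - μ (ρ t (b t)) * vx (t, b t) - Pext) t
  momentum : ∀ t x, 0 < t → x ∈ Ioo (a t) (b t) →
    HasDerivAt (fun y => μ (ρ t y) * vx (t, y) - P (ρ t y))
      (ρ t x * (vt (t, x) + v t x * vx (t, x))) x
  effective_velocity : ∀ p ∈ openDomain a b, ∃ L : ℝ × ℝ →L[ℝ] ℝ,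
    HasFDerivAt (fun q => v q.1 q.2 + μ (ρ q.1 q.2) / ρ q.1 q.2 ^ 2 * ρx q) L p ∧
      ρ p.1 p.2 * (L (1, 0) + v p.1 p.2 * L (0, 1)) = -(deriv P (ρ p.1 p.2) * ρx p)

lemma isOpen_openDomain {a b : ℝ → ℝ} (ha : ContinuousOn a (Ioi 0)) (hb : ContinuousOn b (Ioi 0)) :
    IsOpen (openDomain a b) := by
  rw [isOpen_iff_mem_nhds]
  rintro p ⟨h0, h1, h2⟩
  have ca : ContinuousAt (fun q : ℝ × ℝ => a q.1) p :=
    ContinuousAt.comp (f := Prod.fst) (ha.continuousAt (Ioi_mem_nhds h0)) continuousAt_fst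
  have cb : ContinuousAt (fun q : ℝ × ℝ => b q.1) p :=
    ContinuousAt.comp (f := Prod.fst) (hb.continuousAt (Ioi_mem_nhds h0)) continuousAt_fst
  filter_upwards [continuousAt_fst.eventually_const_lt h0,
    ca.eventually_lt continuousAt_snd h1, continuousAt_snd.eventually_lt cb h2] with q k0 k1 k2
  exact ⟨k0, k1, k2⟩

namespace AssumptionH

variable {P μ : ℝ → ℝ}

lemma hasDerivAt_P (hH : AssumptionH P μ) {r : ℝ} (hr : 0 < r) : HasDerivAt P (deriv P r) r :=
  ((hH.contDiff_P.contDiffAt (Ioi_mem_nhds hr)).differentiableAt (by norm_num)).hasDerivAt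

lemma hasDerivAt_μ (hH : AssumptionH P μ) {r : ℝ} (hr : 0 < r) : HasDerivAt μ (deriv μ r) r :=
  ((hH.contDiff_μ.contDiffAt (Ioi_mem_nhds hr)).differentiableAt (by norm_num)).hasDerivAt

lemma continuousOn_deriv_P (hH : AssumptionH P μ) : ContinuousOn (deriv P) (Ioi 0) :=
  hH.contDiff_P.continuousOn_deriv_of_isOpen isOpen_Ioi (by norm_num)

end AssumptionH

/-- Along a classical solution the effective velocity `v + μ(ρ) ρ_x / ρ²` is accelerated by the
pressure gradient only. -/
lemma momentum_flux_and_effective_velocity {P μ : ℝ → ℝ} (hH : AssumptionH P μ) {a b : ℝ → ℝ}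
    {ρ v : ℝ × ℝ → ℝ} {ρx : ℝ × ℝ → ℝ}
    (hΩ : IsOpen (openDomain a b))
    (hρ2 : ContDiffOn ℝ 2 ρ (openDomain a b)) (hρ0 : ∀ p ∈ openDomain a b, 0 < ρ p)
    (hv1 : ContDiffOn ℝ 1 v (openDomain a b))
    (hv2 : ∀ t, 0 < t → ContDiffOn ℝ 2 (fun x => v (t, x)) (Ioo (a t) (b t)))
    (hρx : ∀ p ∈ openDomain a b, ρx p = fderiv ℝ ρ p (0, 1))
    (hmass : ∀ p ∈ openDomain a b,
      fderiv ℝ ρ p (1, 0) + (fderiv ℝ ρ p (0, 1) * v p + ρ p * fderiv ℝ v p (0, 1)) = 0)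
    (hmom : ∀ p ∈ openDomain a b, ρ p * fderiv ℝ v p (1, 0) + ρ p * v p * fderiv ℝ v p (0, 1) =
      deriv (fun y => μ (ρ (p.1, y)) * deriv (fun x => v (p.1, x)) y - P (ρ (p.1, y))) p.2)
    {p : ℝ × ℝ} (hp : p ∈ openDomain a b) :
    HasDerivAt (fun y => μ (ρ (p.1, y)) * deriv (fun x => v (p.1, x)) y - P (ρ (p.1, y)))
      (ρ p * (fderiv ℝ v p (1, 0) + v p * fderiv ℝ v p (0, 1))) p.2 ∧
    ∃ L : ℝ × ℝ →L[ℝ] ℝ, HasFDerivAt (fun q => v q + μ (ρ q) / ρ q ^ 2 * ρx q) L p ∧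
      ρ p * (L (1, 0) + v p * L (0, 1)) = -(deriv P (ρ p) * ρx p) := by
  have hρp := hρ0 p hp
  have hnh := hΩ.mem_nhds hp
  have dρ : ∀ q ∈ openDomain a b, HasFDerivAt ρ (fderiv ℝ ρ q) q := fun q hq =>
    ((hρ2.contDiffAt (hΩ.mem_nhds hq)).differentiableAt (by norm_num)).hasFDerivAt
  have dv : ∀ q ∈ openDomain a b, HasFDerivAt v (fderiv ℝ v q) q := fun q hq =>
    ((hv1.contDiffAt (hΩ.mem_nhds hq)).differentiableAt (by norm_num)).hasFDerivAt
  have ddρ : HasFDerivAt (fderiv ℝ ρ) (fderiv ℝ (fderiv ℝ ρ) p) p :=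
    (((hρ2.fderiv_of_isOpen hΩ (m := 1) (by norm_num)).contDiffAt hnh).differentiableAt
      (by norm_num)).hasFDerivAt
  have hsymm : fderiv ℝ (fderiv ℝ ρ) p (1, 0) (0, 1) = fderiv ℝ (fderiv ℝ ρ) p (0, 1) (1, 0) :=
    ContDiffAt.isSymmSndFDerivAt (hρ2.contDiffAt hnh) (by simp) _ _
  have ddρe : ∀ e : ℝ × ℝ, HasFDerivAt (fun q => fderiv ℝ ρ q e)
      ((fderiv ℝ (fderiv ℝ ρ) p).flip e) p := fun e => by
    have := ((ContinuousLinearMap.apply ℝ ℝ e).hasFDerivAt).comp p ddρ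
    exact this.congr_fderiv (by ext <;> simp)
  have hslice : ∀ᶠ y in 𝓝 p.2, (p.1, y) ∈ openDomain a b :=
    (Continuous.continuousAt (by fun_prop : Continuous fun y : ℝ => (p.1, y))).eventually_mem
      (by simpa using hnh)
  have evx : ∀ q ∈ openDomain a b, deriv (fun x => v (q.1, x)) q.2 = fderiv ℝ v q (0, 1) :=
    fun q hq => (hasDerivAt_slice (dv q hq)).deriv
  have hI : p.2 ∈ Ioo (a p.1) (b p.1) := hp.2
  have hvxx : HasDerivAt (deriv (fun x => v (p.1, x))) (deriv (deriv (fun x => v (p.1, x))) p.2)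
      p.2 :=
    ((((hv2 p.1 hp.1).deriv_of_isOpen (m := 1) isOpen_Ioo (by norm_num)).contDiffAt
      (isOpen_Ioo.mem_nhds hI)).differentiableAt (by norm_num)).hasDerivAt
  set vxx := deriv (deriv (fun x => v (p.1, x))) p.2 with hvxxdef
  have hvxp : deriv (fun x => v (p.1, x)) p.2 = fderiv ℝ v p (0, 1) := evx p hp
  have dρy := hasDerivAt_slice (dρ p hp)
  have dvy := hasDerivAt_slice (dv p hp)
  have dρxy := hasDerivAt_slice (ddρe (0, 1))
  have dρty := hasDerivAt_slice (ddρe (1, 0))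
  have dμ : HasDerivAt (fun y => μ (ρ (p.1, y))) (deriv μ (ρ p) * fderiv ℝ ρ p (0, 1)) p.2 :=
    HasDerivAt.comp (h := fun y => ρ (p.1, y)) p.2 (hH.hasDerivAt_μ hρp) dρy
  have dP : HasDerivAt (fun y => P (ρ (p.1, y))) (deriv P (ρ p) * fderiv ℝ ρ p (0, 1)) p.2 :=
    HasDerivAt.comp (h := fun y => ρ (p.1, y)) p.2 (hH.hasDerivAt_P hρp) dρy
  have hflux := (dμ.mul hvxx).sub dP
  have hmom' := hmom p hp
  have hflux' : deriv (fun y => μ (ρ (p.1, y)) * deriv (fun x => v (p.1, x)) y - P (ρ (p.1, y)))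
      p.2 = _ := hflux.deriv
  rw [hflux'] at hmom'
  -- Differentiating the mass equation in $x$ expresses $\rho_{xt}$ through $v_{xx}$. Only
  -- regularity of $v(t,\cdot)$ is used, as $v$ is merely $C^1$ jointly. The resulting $-\mu v_{xx}$
  -- cancels the one in the momentum equation.
  have hmassx := (dρty.add ((dρxy.mul dvy).add (dρy.mul hvxx)))
  have hmassx0 := hmassx.unique ((hasDerivAt_const p.2 (0 : ℝ)).congr_of_eventuallyEq (by
    filter_upwards [hslice] with y hy
    have := hmass _ hy
    simp only [Pi.add_apply, Pi.mul_apply]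
    rw [evx _ hy]
    exact this))
  have hmass' := hmass p hp
  refine ⟨hflux.congr_deriv (by rw [← hmom']; ring), ?_⟩
  have h1 : HasFDerivAt (fun q => μ (ρ q) / ρ q ^ 2) (((deriv μ (ρ p) * ρ p ^ 2 -
      μ (ρ p) * (2 * ρ p)) / (ρ p ^ 2) ^ 2) • fderiv ℝ ρ p) p := by
    have : HasDerivAt (fun r => μ r / r ^ 2) ((deriv μ (ρ p) * ρ p ^ 2 -
      μ (ρ p) * (2 * ρ p)) / (ρ p ^ 2) ^ 2) (ρ p) := by
      refine ((hH.hasDerivAt_μ hρp).div (hasDerivAt_pow 2 _) (by positivity)).congr_deriv ?_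
      simp
    exact this.comp_hasFDerivAt p (dρ p hp)
  have h2 : HasFDerivAt ρx ((fderiv ℝ (fderiv ℝ ρ) p).flip (0, 1)) p :=
    (ddρe (0, 1)).congr_of_eventuallyEq (by filter_upwards [hnh] with q hq; exact hρx q hq)
  refine ⟨_, (dv p hp).add (h1.mul h2), ?_⟩
  simp only [hρx p hp, hvxp] at *
  simp only [add_apply, smul_apply, smul_eq_mul,
    ContinuousLinearMap.flip_apply] at *
  rw [hsymm]
  generalize fderiv ℝ (fderiv ℝ ρ) p (0, 1) (0, 1) = ρxx at *
  generalize fderiv ℝ (fderiv ℝ ρ) p (0, 1) (1, 0) = ρxt at *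
  generalize fderiv ℝ ρ p (0, 1) = rx at *
  generalize fderiv ℝ ρ p (1, 0) = rt at *
  generalize fderiv ℝ v p (0, 1) = wx at *
  generalize fderiv ℝ v p (1, 0) = wt at *
  have e1 : ρxt = -(ρxx * v p + rx * wx + (rx * wx + ρ p * vxx)) := by linarith
  have e2 : rt = -(rx * v p + ρ p * wx) := by linarith
  subst e1 e2
  field_simp
  linear_combination (ρ p) ^ 2 * hmom'

/-- The regularity classes are unpacked here once. The balance laws below work with the extended
partial derivatives. -/
lemma IsClassicalSolution.exists_hasPartials {P μ : ℝ → ℝ} (hH : AssumptionH P μ) {Pext : ℝ}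
    {u a b : ℝ → ℝ} {ρ v : ℝ → ℝ → ℝ} (h : IsClassicalSolution P μ Pext u a b ρ v) :
    ∃ ρt ρx vt vx : ℝ × ℝ → ℝ, HasPartials P μ Pext u a b ρ v ρt ρx vt vx := by
  obtain ⟨-, ρ1, gρ, hgρ, hgρ'⟩ := h.ρ_C1
  obtain ⟨cv, v1, gv, hgv, hgv'⟩ := h.v_C1
  have cρ := h.ρ_C1.1
  have ca : ContinuousOn a (Ioi 0) := h.a_C2.continuousOn
  have cb : ContinuousOn b (Ioi 0) := h.b_C2.continuousOn
  have hΩ : IsOpen (openDomain a b) := isOpen_openDomain ca cb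
  have hlc := lateralDomain_subset_closedDomain a b
  have hol := openDomain_subset_lateralDomain a b
  have dρ : ∀ p ∈ openDomain a b, HasFDerivAt (Function.uncurry ρ) (gρ p) p := fun p hp => by
    rw [hgρ' p hp]
    exact ((ρ1.contDiffAt (hΩ.mem_nhds hp)).differentiableAt (by norm_num)).hasFDerivAt
  have dv : ∀ p ∈ openDomain a b, HasFDerivAt (Function.uncurry v) (gv p) p := fun p hp => by
    rw [hgv' p hp]
    exact ((v1.contDiffAt (hΩ.mem_nhds hp)).differentiableAt (by norm_num)).hasFDerivAt
  have hda : ∀ t, 0 < t → deriv a t = v t (a t) := fun t ht =>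
    ((h.velocity_a t ht.le).hasDerivAt (Ici_mem_nhds ht)).deriv
  have hdb : ∀ t, 0 < t → deriv b t = v t (b t) := fun t ht =>
    ((h.velocity_b t ht.le).hasDerivAt (Ici_mem_nhds ht)).deriv
  have cev : ∀ {A : Set (ℝ × ℝ)} {g : ℝ × ℝ → (ℝ × ℝ →L[ℝ] ℝ)} (e : ℝ × ℝ),
      ContinuousOn g A → ContinuousOn (fun p => g p e) A := fun e hg =>
    hg.clm_apply continuousOn_const
  have dρx : ∀ p ∈ openDomain a b, HasDerivAt (ρ p.1) (gρ p (0, 1)) p.2 := fun p hp =>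
    hasDerivAt_slice (dρ p hp)
  have dvx : ∀ p ∈ openDomain a b, HasDerivAt (v p.1) (gv p (0, 1)) p.2 := fun p hp =>
    hasDerivAt_slice (dv p hp)
  have hmassΩ : ∀ p ∈ openDomain a b,
      gρ p (1, 0) + (gρ p (0, 1) * v p.1 p.2 + ρ p.1 p.2 * gv p (0, 1)) = 0 := by
    rintro ⟨t, x⟩ hp
    have := h.mass t x hp.1 hp.2
    have e1 : deriv (fun s => ρ s x) t = gρ (t, x) (1, 0) :=
      (hasDerivAt_slice_left (dρ _ hp)).deriv
    have e2 : deriv (fun y => ρ t y * v t y) x = _ := ((dρx _ hp).mul (dvx _ hp)).deriv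
    rw [e1, e2] at this
    exact this
  have hslc : ∀ t, 0 ≤ t → MapsTo (fun y : ℝ => (t, y)) (Icc (a t) (b t)) (closedDomain a b) :=
    fun t ht y hy => ⟨ht, hy⟩
  have hsll : ∀ t, 0 < t → MapsTo (fun y : ℝ => (t, y)) (Icc (a t) (b t)) (lateralDomain a b) :=
    fun t ht y hy => ⟨ht, hy⟩
  have hcs : ∀ (t : ℝ) (A : Set ℝ), ContinuousOn (fun y : ℝ => (t, y)) A := fun t A => by fun_prop
  have cρt := cev (1, 0) hgρ
  have cρx := cev (0, 1) hgρ
  have cvt := cev (1, 0) hgv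
  have cvx := cev (0, 1) hgv
  have hmassL : ∀ p ∈ lateralDomain a b,
      gρ p (1, 0) + gρ p (0, 1) * v p.1 p.2 + ρ p.1 p.2 * gv p (0, 1) = 0 := by
    rintro ⟨t, x⟩ hp
    have hc : ContinuousOn (fun p : ℝ × ℝ => gρ p (1, 0) + gρ p (0, 1) * v p.1 p.2
        + ρ p.1 p.2 * gv p (0, 1)) (lateralDomain a b) :=
      (((cρt.mono hlc).add ((cρx.mono hlc).mul cv))).add ((cρ.mono hlc).mul cvx)
    have hc' := hc.comp (hcs t _) (hsll t hp.1)
    -- On each time slice the open interval is dense in the closed one, so the mass equation passes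
    -- to the pistons.
    have heq : EqOn _ (fun _ => (0 : ℝ)) (Icc (a t) (b t)) := EqOn.of_subset_closure
      (s := Ioo (a t) (b t)) (fun y hy => by
        have := hmassΩ (t, y) ⟨hp.1, hy.1, hy.2⟩
        simp only [Function.comp]
        linarith) hc' continuousOn_const Ioo_subset_Icc_self
      (by rw [closure_Ioo (h.a_lt_b t hp.1.le).ne])
    exact heq hp.2
  have evx : ∀ t, 0 < t → ∀ x ∈ Ioo (a t) (b t), HasDerivAt (v t) (gv (t, x) (0, 1)) x :=
    fun t ht x hx => dvx (t, x) ⟨ht, hx⟩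
  have aux := fun {p : ℝ × ℝ} (hp : p ∈ openDomain a b) => momentum_flux_and_effective_velocity hH
    (ρ := Function.uncurry ρ) (v := Function.uncurry v) (ρx := fun p => gρ p (0, 1)) hΩ h.ρ_C2
    (fun p hp => h.ρ_pos p.1 p.2 hp.1.le ⟨hp.2.1.le, hp.2.2.le⟩) v1 h.v_C2
    (fun p hp => by rw [hgρ' p hp])
    (fun p hp => by rw [← hgρ' p hp, ← hgv' p hp]; exact hmassΩ p hp)
    (fun p hp => by
      have hm := h.momentum p.1 p.2 hp.1 hp.2
      have e1 : deriv (fun s => v s p.2) p.1 = gv p (1, 0) :=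
        (hasDerivAt_slice_left (dv p hp)).deriv
      rw [e1, (dvx p hp).deriv, hgv' p hp] at hm
      exact hm) hp
  refine ⟨fun p => gρ p (1, 0), fun p => gρ p (0, 1), fun p => gv p (1, 0),
    fun p => gv p (0, 1), ⟨cρt, cρx, cvt, cvx, fun p hp => ⟨_, dρ p hp, rfl, rfl⟩,
    fun p hp => ⟨_, dv p hp, rfl, rfl⟩, ?_, hmassL, ?_, ?_, ?_, ?_, ?_, ?_⟩⟩
  · intro t x ht hx
    rcases ht.eq_or_lt with rfl | ht
    · exact hasDerivAt_initial h.a_C1.continuousOn h.b_C1.continuousOn cρ hgρ dρ hx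
    · exact dρx (t, x) ⟨ht, hx⟩
  · intro t ht
    -- Following $\theta=0$ means following the left piston, so the derivative is
    -- $\rho_t+v\rho_x=-\rho v_x$.
    have := hasDerivAt_comp_stretch (θ := 0) (h.a_C2.of_le (by norm_num))
      (h.b_C2.of_le (by norm_num)) (fun t ht => h.a_lt_b t ht.le) (cρ.mono hlc) (hgρ.mono hlc) dρ
      ht (by simp)
    have hm := hmassL (t, a t) ⟨ht, le_rfl, (h.a_lt_b t ht.le).le⟩
    rw [apply_pair] at this
    simp only [stretch, mul_zero, add_zero, hda t ht, Function.uncurry_apply_pair] at this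
    refine this.congr_deriv ?_
    simp only at hm
    linarith
  · intro t ht
    have := hasDerivAt_comp_stretch (θ := 1) (h.a_C2.of_le (by norm_num))
      (h.b_C2.of_le (by norm_num)) (fun t ht => h.a_lt_b t ht.le) (cρ.mono hlc) (hgρ.mono hlc) dρ
      ht (by simp)
    have hm := hmassL (t, b t) ⟨ht, (h.a_lt_b t ht.le).le, le_rfl⟩
    rw [apply_pair] at this
    simp only [stretch, mul_one, add_sub_cancel, hdb t ht, Function.uncurry_apply_pair] at this
    refine this.congr_deriv ?_
    simp only at hm
    linarith
  · intro t ht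
    have hd : HasDerivAt (deriv a) (deriv (deriv a) t) t :=
      (((h.a_C2.deriv_of_isOpen (m := 1) isOpen_Ioi (by norm_num)).contDiffAt
        (Ioi_mem_nhds ht)).differentiableAt (by norm_num)).hasDerivAt
    rw [h.newton_a t ht, derivWithin_Icc_left (f := v t) (h.a_lt_b t ht.le)
      (h.v_C0.comp (hcs t _) (hslc t ht.le)) (cvx.comp (hcs t _) (hsll t ht)) (evx t ht)] at hd
    refine hd.congr_of_eventuallyEq ?_
    filter_upwards [Ioi_mem_nhds ht] with s hs using (hda s hs).symm
  · intro t ht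
    have hd : HasDerivAt (deriv b) (deriv (deriv b) t) t :=
      (((h.b_C2.deriv_of_isOpen (m := 1) isOpen_Ioi (by norm_num)).contDiffAt
        (Ioi_mem_nhds ht)).differentiableAt (by norm_num)).hasDerivAt
    rw [h.newton_b t ht, derivWithin_Icc_right (f := v t) (h.a_lt_b t ht.le)
      (h.v_C0.comp (hcs t _) (hslc t ht.le)) (cvx.comp (hcs t _) (hsll t ht)) (evx t ht)] at hd
    refine hd.congr_of_eventuallyEq ?_
    filter_upwards [Ioi_mem_nhds ht] with s hs using (hdb s hs).symm
  · intro t x ht hx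
    have hp : (t, x) ∈ openDomain a b := ⟨ht, hx⟩
    have h1 := (aux hp).1
    rw [← hgv' _ hp] at h1
    refine h1.congr_of_eventuallyEq ?_
    filter_upwards [Ioo_mem_nhds hx.1 hx.2] with y hy
    have := (evx t ht y hy).deriv
    simp only [Function.uncurry_apply_pair]
    rw [this]
  · intro p hp
    exact (aux hp).2

/-! ### Calculus of $k$ and $Q$. -/

namespace AssumptionH

variable {P μ : ℝ → ℝ}

lemma continuousOn_P (hH : AssumptionH P μ) : ContinuousOn P (Ioi 0) := hH.contDiff_P.continuousOn

lemma continuousOn_μ (hH : AssumptionH P μ) : ContinuousOn μ (Ioi 0) := hH.contDiff_μ.continuousOn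

lemma hasDerivAt_integral {f : ℝ → ℝ} (hf : ContinuousOn f (Ioi 0)) {c r : ℝ} (hc : 0 < c)
    (hr : 0 < r) : HasDerivAt (fun r => ∫ τ in c..r, f τ) (f r) r := by
  refine intervalIntegral.integral_hasDerivAt_right ?_
    (hf.stronglyMeasurableAtFilter isOpen_Ioi r hr) (hf.continuousAt (Ioi_mem_nhds hr))
  exact (hf.mono fun x hx => lt_of_lt_of_le (lt_min hc hr) hx.1).intervalIntegrable

lemma hasDerivAt_k (hH : AssumptionH P μ) {ρs r : ℝ} (hρs : 0 < ρs) (hr : 0 < r) :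
    HasDerivAt (k μ ρs) (μ r / r) r :=
  hasDerivAt_integral (hH.continuousOn_μ.div continuousOn_id fun _ hx => ne_of_gt hx) hρs hr

lemma continuousOn_P_div (hH : AssumptionH P μ) : ContinuousOn (fun τ => P τ / τ ^ 2) (Ioi 0) :=
  hH.continuousOn_P.div (continuousOn_pow 2) fun _ hx => pow_ne_zero 2 (ne_of_gt hx)

/-- In this form $rQ'(r)-Q(r)=P(r)-P(\rho^*)$, the identity behind the rate of $U$. -/
lemma hasDerivAt_Q (hH : AssumptionH P μ) {ρs r : ℝ} (hρs : 0 < ρs) (hr : 0 < r) :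
    HasDerivAt (Q P ρs) ((Q P ρs r + P r - P ρs) / r) r := by
  have h1 := hasDerivAt_integral hH.continuousOn_P_div hρs hr
  have := ((((hasDerivAt_id r).mul h1).sub ((hasDerivAt_id r).const_mul (P ρs / ρs)))).add_const
    (P ρs)
  refine this.congr_deriv ?_
  simp only [Q, id]
  field_simp
  ring

/-- The linear terms of $Q$ are $-r\int_{\rho^*}^r P(\rho^*)\tau^{-2}\,d\tau$. Absorbing them into
the integral exposes the sign of $Q$ and its quadratic vanishing at $\rho^*$. -/
lemma Q_eq (hH : AssumptionH P μ) {ρs r : ℝ} (hρs : 0 < ρs) (hr : 0 < r) :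
    Q P ρs r = r * ∫ τ in ρs..r, (P τ - P ρs) / τ ^ 2 := by
  have hsub : uIcc ρs r ⊆ Ioi 0 := fun x hx => lt_of_lt_of_le (lt_min hρs hr) hx.1
  have hd : ∀ x ∈ uIcc ρs r, HasDerivAt (fun x => -(P ρs / x)) (P ρs / x ^ 2) x := fun x hx => by
    have hx0 : x ≠ 0 := ne_of_gt (hsub hx)
    have := (((hasDerivAt_inv hx0).const_mul (P ρs))).neg
    refine (this.congr_of_eventuallyEq (Eventually.of_forall fun y => ?_)).congr_deriv ?_
    · simp [div_eq_mul_inv]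
    · field_simp
  have hc : ContinuousOn (fun x => P ρs / x ^ 2) (uIcc ρs r) :=
    continuousOn_const.div (continuousOn_pow 2) fun _ hx => pow_ne_zero 2 (ne_of_gt (hsub hx))
  have h2 := intervalIntegral.integral_eq_sub_of_hasDerivAt hd hc.intervalIntegrable
  have h3 := intervalIntegral.integral_sub (hH.continuousOn_P_div.mono hsub).intervalIntegrable
    (μ := volume) hc.intervalIntegrable
  simp only [sub_div]
  rw [h3, h2, Q]
  field_simp
  ring

lemma strictMonoOn_P (hH : AssumptionH P μ) : StrictMonoOn P (Ioi 0) :=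
  strictMonoOn_of_deriv_pos (convex_Ioi 0) hH.continuousOn_P fun x hx =>
    hH.deriv_P_pos x (by rwa [interior_Ioi] at hx)

lemma Q_nonneg (hH : AssumptionH P μ) {ρs r : ℝ} (hρs : 0 < ρs) (hr : 0 < r) :
    0 ≤ Q P ρs r := by
  rw [hH.Q_eq hρs hr]
  refine mul_nonneg hr.le ?_
  rcases le_total ρs r with h | h
  · refine intervalIntegral.integral_nonneg h fun x hx => div_nonneg ?_ (sq_nonneg x)
    have := hH.strictMonoOn_P.monotoneOn hρs (lt_of_lt_of_le hρs hx.1) hx.1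
    linarith
  · rw [intervalIntegral.integral_symm, ← intervalIntegral.integral_neg]
    refine intervalIntegral.integral_nonneg h fun x hx => ?_
    rw [← neg_div]
    refine div_nonneg ?_ (sq_nonneg x)
    have := hH.strictMonoOn_P.monotoneOn (lt_of_lt_of_le hr hx.1) hρs hx.2
    linarith

lemma continuousOn_k (hH : AssumptionH P μ) {ρs : ℝ} (hρs : 0 < ρs) :
    ContinuousOn (k μ ρs) (Ioi 0) := fun _ hr =>
  (hH.hasDerivAt_k hρs hr).continuousAt.continuousWithinAt

lemma continuousOn_Q (hH : AssumptionH P μ) {ρs : ℝ} (hρs : 0 < ρs) :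
    ContinuousOn (Q P ρs) (Ioi 0) := fun _ hr =>
  (hH.hasDerivAt_Q hρs hr).continuousAt.continuousWithinAt

end AssumptionH

/-! ### Fixed-time profiles and the effective-velocity form of $W$. -/

/-- A density profile `ρ` of unit mass with derivative `ρx`, and a velocity profile `v`, on
`[a, b]`. -/
structure IsProfile (a b : ℝ) (ρ ρx v : ℝ → ℝ) : Prop where
  lt : a < b
  continuousOn_ρ : ContinuousOn ρ (Icc a b)
  continuousOn_ρx : ContinuousOn ρx (Icc a b)
  continuousOn_v : ContinuousOn v (Icc a b)
  pos : ∀ x ∈ Icc a b, 0 < ρ x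
  hasDerivAt_ρ : ∀ x ∈ Ioo a b, HasDerivAt ρ (ρx x) x
  total_mass : ∫ x in a..b, ρ x = 1

lemma IsClassicalSolution.isProfile {P μ : ℝ → ℝ} {Pext : ℝ}
    {u a b : ℝ → ℝ} {ρ v : ℝ → ℝ → ℝ} (h : IsClassicalSolution P μ Pext u a b ρ v)
    {ρt ρx vt vx : ℝ × ℝ → ℝ} (hp : HasPartials P μ Pext u a b ρ v ρt ρx vt vx) {t : ℝ}
    (ht : 0 ≤ t) : IsProfile (a t) (b t) (ρ t) (fun x => ρx (t, x)) (v t) := by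
  have hm : MapsTo (fun y : ℝ => (t, y)) (Icc (a t) (b t)) (closedDomain a b) :=
    fun y hy => ⟨ht, hy⟩
  have hc : ContinuousOn (fun y : ℝ => (t, y)) (Icc (a t) (b t)) := by fun_prop
  exact ⟨h.a_lt_b t ht, h.ρ_C1.1.comp hc hm, hp.continuousOn_ρx.comp hc hm, h.v_C0.comp hc hm,
    fun x hx => h.ρ_pos t x ht hx, fun x hx => hp.hasDerivAt_ρ t x ht hx, h.total_mass t ht⟩

/-- Since $k'(r)=\mu(r)/r$, the integrand is $\rho w^2$ in the interior, and the end points are a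
null set. The right side involves only functions continuous up to the boundary. -/
lemma W_eq {P μ : ℝ → ℝ} (hH : AssumptionH P μ) {ρs : ℝ} (hρs : 0 < ρs) {a b : ℝ} {ρ ρx v : ℝ → ℝ}
    (hp : IsProfile a b ρ ρx v) :
    W P μ ρs a b ρ v = (1 / 2) * (∫ x in a..b, ρ x * (v x + μ (ρ x) / ρ x ^ 2 * ρx x) ^ 2)
      + (1 / 2) * (v b - k μ ρs (ρ b)) ^ 2 + (1 / 2) * (v a + k μ ρs (ρ a)) ^ 2
      + U P ρs a b ρ := by
  have : ∫ x in a..b, 1 / ρ x * (ρ x * v x + deriv (fun y => k μ ρs (ρ y)) x) ^ 2 =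
      ∫ x in a..b, ρ x * (v x + μ (ρ x) / ρ x ^ 2 * ρx x) ^ 2 := by
    rw [intervalIntegral.integral_of_le hp.lt.le, intervalIntegral.integral_of_le hp.lt.le,
      integral_Ioc_eq_integral_Ioo, integral_Ioc_eq_integral_Ioo]
    refine setIntegral_congr_fun measurableSet_Ioo fun x hx => ?_
    have hpos := hp.pos x (Ioo_subset_Icc_self hx)
    have hd : deriv (fun y => k μ ρs (ρ y)) x = _ :=
      (HasDerivAt.comp (h := ρ) x (hH.hasDerivAt_k hρs hpos) (hp.hasDerivAt_ρ x hx)).deriv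
    simp only [hd]
    field_simp
  rw [W, this]

/-! ### Balance laws along solutions. -/

section Rates

variable {P μ : ℝ → ℝ} {ρs Pext : ℝ} {u a b : ℝ → ℝ} {ρ v : ℝ → ℝ → ℝ} {ρt ρx vt vx : ℝ × ℝ → ℝ}

lemma IsClassicalSolution.transport (h : IsClassicalSolution P μ Pext u a b ρ v)
    (hp : HasPartials P μ Pext u a b ρ v ρt ρx vt vx) {f g : ℝ × ℝ → ℝ}
    (hf : ContinuousOn f (lateralDomain a b)) (hg : ContinuousOn g (lateralDomain a b))
    (hfg : ∀ p ∈ openDomain a b, ∃ f' : ℝ × ℝ →L[ℝ] ℝ, HasFDerivAt f f' p ∧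
      f' (1, 0) + f' (0, 1) * v p.1 p.2 + f p * vx p = g p) {t : ℝ} (ht : 0 < t) :
    HasDerivAt (fun t => ∫ x in (a t)..(b t), f (t, x)) (∫ x in (a t)..(b t), g (t, x)) t := by
  refine hasDerivAt_integral_of_transport (v := Function.uncurry v) h.a_C2 h.b_C2
    (fun t ht => h.a_lt_b t ht.le)
    (fun t ht => ((h.velocity_a t ht.le).hasDerivAt (Ici_mem_nhds ht)).deriv)
    (fun t ht => ((h.velocity_b t ht.le).hasDerivAt (Ici_mem_nhds ht)).deriv)
    h.v_C1.1 hf hg (fun p hpΩ => ?_) ht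
  obtain ⟨f', h1, h2⟩ := hfg p hpΩ
  obtain ⟨v', h3, -, h4⟩ := hp.hasFDerivAt_v p hpΩ
  exact ⟨f', v', h1, h3, by rw [h4]; exact h2⟩

lemma IsClassicalSolution.continuousOn_comp_ρ (h : IsClassicalSolution P μ Pext u a b ρ v)
    {F : ℝ → ℝ} (hF : ContinuousOn F (Ioi 0)) :
    ContinuousOn (fun p : ℝ × ℝ => F (ρ p.1 p.2)) (closedDomain a b) :=
  hF.comp h.ρ_C1.1 fun p hp => h.ρ_pos p.1 p.2 hp.1 hp.2

lemma IsClassicalSolution.ρ_pos' (h : IsClassicalSolution P μ Pext u a b ρ v) {p : ℝ × ℝ}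
    (hp : p ∈ closedDomain a b) : 0 < ρ p.1 p.2 := h.ρ_pos p.1 p.2 hp.1 hp.2

lemma continuousOn_slice {f : ℝ × ℝ → ℝ} (hf : ContinuousOn f (lateralDomain a b)) {t : ℝ}
    (ht : 0 < t) : ContinuousOn (fun x => f (t, x)) (Icc (a t) (b t)) :=
  hf.comp (by fun_prop) fun _ hx => ⟨ht, hx⟩

lemma IsClassicalSolution.intervalIntegrable_slice (h : IsClassicalSolution P μ Pext u a b ρ v)
    {f : ℝ × ℝ → ℝ} (hf : ContinuousOn f (lateralDomain a b)) {t : ℝ} (ht : 0 < t) :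
    IntervalIntegrable (fun x => f (t, x)) volume (a t) (b t) := by
  refine ContinuousOn.intervalIntegrable ?_
  rw [uIcc_of_le (h.a_lt_b t ht.le).le]
  exact continuousOn_slice hf ht

lemma IsClassicalSolution.hasDerivAt_U (hH : AssumptionH P μ) (hρs : 0 < ρs)
    (h : IsClassicalSolution P μ Pext u a b ρ v)
    (hp : HasPartials P μ Pext u a b ρ v ρt ρx vt vx) {t : ℝ} (ht : 0 < t) :
    HasDerivAt (fun t => U P ρs (a t) (b t) (ρ t))
      (∫ x in (a t)..(b t), -((P (ρ t x) - P ρs) * vx (t, x))) t := by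
  have hlc := lateralDomain_subset_closedDomain a b
  refine h.transport hp (f := fun p => Q P ρs (ρ p.1 p.2))
    (g := fun p => -((P (ρ p.1 p.2) - P ρs) * vx p))
    ((h.continuousOn_comp_ρ (hH.continuousOn_Q hρs)).mono hlc)
    (((((h.continuousOn_comp_ρ hH.continuousOn_P).mono hlc).sub continuousOn_const).mul
      hp.continuousOn_vx).neg) (fun p hpΩ => ?_) ht
  have hpL := openDomain_subset_lateralDomain a b hpΩ
  have hpos := h.ρ_pos' (hlc hpL)
  obtain ⟨L, h1, h2, h3⟩ := hp.hasFDerivAt_ρ p hpΩ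
  refine ⟨_, (hH.hasDerivAt_Q hρs hpos).comp_hasFDerivAt (f := Function.uncurry ρ) p h1, ?_⟩
  have hm := hp.mass p hpL
  have e : ρt p = -(ρx p * v p.1 p.2 + ρ p.1 p.2 * vx p) := by linarith
  simp only [smul_apply, h2, h3, smul_eq_mul, e]
  field_simp
  ring

/-- The energy balance. -/
lemma IsClassicalSolution.hasDerivAt_E (hH : AssumptionH P μ) (hρs : 0 < ρs) (hP : P ρs = Pext)
    (h : IsClassicalSolution P μ Pext u a b ρ v)
    (hp : HasPartials P μ Pext u a b ρ v ρt ρx vt vx) {t : ℝ} (ht : 0 < t) :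
    HasDerivAt (fun t => E P ρs (a t) (b t) (ρ t) (v t))
      (u t * v t (a t) - ∫ x in (a t)..(b t), μ (ρ t x) * vx (t, x) ^ 2) t := by
  have hlc := lateralDomain_subset_closedDomain a b
  have cρ : ContinuousOn (fun p : ℝ × ℝ => ρ p.1 p.2) (lateralDomain a b) := h.ρ_C1.1.mono hlc
  have cP := (h.continuousOn_comp_ρ hH.continuousOn_P).mono hlc
  have cμ := (h.continuousOn_comp_ρ hH.continuousOn_μ).mono hlc
  have cv : ContinuousOn (fun p : ℝ × ℝ => v p.1 p.2) (lateralDomain a b) := h.v_C1.1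
  have cvx := hp.continuousOn_vx
  have cg : ContinuousOn (fun p : ℝ × ℝ => 2 * (v p.1 p.2 * (ρ p.1 p.2 *
      (vt p + v p.1 p.2 * vx p)))) (lateralDomain a b) :=
    continuousOn_const.mul (cv.mul (cρ.mul (hp.continuousOn_vt.add (cv.mul cvx))))
  have hkin := h.transport hp (f := fun p => ρ p.1 p.2 * v p.1 p.2 ^ 2)
    (g := fun p => 2 * (v p.1 p.2 * (ρ p.1 p.2 * (vt p + v p.1 p.2 * vx p))))
    (cρ.mul (cv.pow 2)) cg
    (fun p hpΩ => by
      have hpL := openDomain_subset_lateralDomain a b hpΩ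
      obtain ⟨L, h1, h2, h3⟩ := hp.hasFDerivAt_ρ p hpΩ
      obtain ⟨L', h4, h5, h6⟩ := hp.hasFDerivAt_v p hpΩ
      refine ⟨_, h1.mul (h4.pow 2), ?_⟩
      have hm := hp.mass p hpL
      have e : ρt p = -(ρx p * v p.1 p.2 + ρ p.1 p.2 * vx p) := by linarith
      simp only [smul_apply, add_apply, h2, h3, h5, h6, smul_eq_mul, e, Function.uncurry]
      simp
      ring) ht
  have hU := h.hasDerivAt_U hH hρs hp ht
  have hab := h.a_lt_b t ht.le
  -- The momentum equation is tested with $v$. The boundary terms are the gas forces on the pistons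
  -- and cancel those in Newton's laws.
  have hparts := intervalIntegral.integral_eq_sub_of_hasDerivAt_of_le hab.le
    (f := fun x => v t x * (μ (ρ t x) * vx (t, x) - P (ρ t x)))
    (f' := fun x => vx (t, x) * (μ (ρ t x) * vx (t, x) - P (ρ t x)) +
      v t x * (ρ t x * (vt (t, x) + v t x * vx (t, x))))
    (continuousOn_slice (cv.mul ((cμ.mul cvx).sub cP)) ht)
    (fun x hx => by
      obtain ⟨L', h4, h5, h6⟩ := hp.hasFDerivAt_v (t, x) ⟨ht, hx⟩
      have := hasDerivAt_slice h4
      rw [h6] at this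
      exact this.mul (hp.momentum t x ht hx))
    (h.intervalIntegrable_slice ((cvx.mul ((cμ.mul cvx).sub cP)).add
      (cv.mul (cρ.mul (hp.continuousOn_vt.add (cv.mul cvx))))) ht)
  have hdv := intervalIntegral.integral_eq_sub_of_hasDerivAt_of_le hab.le
    (f := v t) (f' := fun x => vx (t, x)) (continuousOn_slice cv ht)
    (fun x hx => by
      obtain ⟨L', h4, h5, h6⟩ := hp.hasFDerivAt_v (t, x) ⟨ht, hx⟩
      have := hasDerivAt_slice h4
      rw [h6] at this
      exact this)
    (h.intervalIntegrable_slice cvx ht)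
  have hva := ((hp.hasDerivAt_v_a t ht).pow 2).div_const 2
  have hvb := ((hp.hasDerivAt_v_b t ht).pow 2).div_const 2
  refine (((hva.add hvb).add (hkin.const_mul (1 / 2))).add hU).congr_deriv ?_
  have i1 : IntervalIntegrable
      (fun x => vx (t, x) * (μ (ρ t x) * vx (t, x) - P (ρ t x))) volume (a t) (b t) :=
    h.intervalIntegrable_slice (cvx.mul ((cμ.mul cvx).sub cP)) ht
  have i2 : IntervalIntegrable
      (fun x => v t x * (ρ t x * (vt (t, x) + v t x * vx (t, x)))) volume (a t) (b t) :=
    h.intervalIntegrable_slice (cv.mul (cρ.mul (hp.continuousOn_vt.add (cv.mul cvx)))) ht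
  have i3 : IntervalIntegrable (fun x => μ (ρ t x) * vx (t, x) ^ 2) volume (a t) (b t) :=
    h.intervalIntegrable_slice (cμ.mul (cvx.pow 2)) ht
  have i4 : IntervalIntegrable (fun x => P (ρ t x) * vx (t, x)) volume (a t) (b t) :=
    h.intervalIntegrable_slice (cP.mul cvx) ht
  have i5 := h.intervalIntegrable_slice cvx ht
  have j1 := intervalIntegral.integral_add (μ := volume) i1 i2
  have j2 : ∫ x in (a t)..(b t), vx (t, x) * (μ (ρ t x) * vx (t, x) - P (ρ t x)) =
      (∫ x in (a t)..(b t), μ (ρ t x) * vx (t, x) ^ 2) -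
        ∫ x in (a t)..(b t), P (ρ t x) * vx (t, x) := by
    rw [← intervalIntegral.integral_sub i3 i4]
    exact intervalIntegral.integral_congr fun x _ => by ring
  have j3 : ∫ x in (a t)..(b t), -((P (ρ t x) - P ρs) * vx (t, x)) =
      P ρs * (∫ x in (a t)..(b t), vx (t, x)) - ∫ x in (a t)..(b t), P (ρ t x) * vx (t, x) := by
    rw [← intervalIntegral.integral_const_mul,
      ← intervalIntegral.integral_sub (i5.const_mul _) i4]
    exact intervalIntegral.integral_congr fun x _ => by ring
  have j4 : ∫ x in (a t)..(b t), 2 * (v t x * (ρ t x * (vt (t, x) + v t x * vx (t, x)))) =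
      2 * ∫ x in (a t)..(b t), v t x * (ρ t x * (vt (t, x) + v t x * vx (t, x))) :=
    intervalIntegral.integral_const_mul _ _
  simp only at j1 j2 j3 j4 hparts hdv ⊢
  rw [j3, j4, hdv]
  rw [j1, j2] at hparts
  rw [← hP]
  norm_num
  linear_combination hparts

/-- The balance for the functional `W`. -/
lemma IsClassicalSolution.hasDerivAt_W (hH : AssumptionH P μ) (hρs : 0 < ρs) (hP : P ρs = Pext)
    (h : IsClassicalSolution P μ Pext u a b ρ v)
    (hp : HasPartials P μ Pext u a b ρ v ρt ρx vt vx) {t : ℝ} (ht : 0 < t) :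
    HasDerivAt (fun t => W P μ ρs (a t) (b t) (ρ t) (v t))
      (-(∫ x in (a t)..(b t), μ (ρ t x) / ρ t x ^ 2 * deriv P (ρ t x) * ρx (t, x) ^ 2)
        - k μ ρs (ρ t (b t)) * (P (ρ t (b t)) - P ρs)
        - k μ ρs (ρ t (a t)) * (P (ρ t (a t)) - P ρs)
        + u t * (v t (a t) + k μ ρs (ρ t (a t)))) t := by
  have hlc := lateralDomain_subset_closedDomain a b
  have cρ : ContinuousOn (fun p : ℝ × ℝ => ρ p.1 p.2) (lateralDomain a b) := h.ρ_C1.1.mono hlc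
  have cρx := hp.continuousOn_ρx.mono hlc
  have cP := (h.continuousOn_comp_ρ hH.continuousOn_P).mono hlc
  have cP' := (h.continuousOn_comp_ρ hH.continuousOn_deriv_P).mono hlc
  have cφ := (h.continuousOn_comp_ρ (hH.continuousOn_μ.div (continuousOn_pow 2)
    fun x hx => pow_ne_zero 2 (ne_of_gt hx))).mono hlc
  have cv : ContinuousOn (fun p : ℝ × ℝ => v p.1 p.2) (lateralDomain a b) := h.v_C1.1
  have cvx := hp.continuousOn_vx
  have cw := cv.add (cφ.mul cρx)
  -- The rate of $\rho w^2$ is $2w$ times the force on $w$, which is the pressure gradient alone.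
  have hkin := h.transport hp
    (f := fun p => ρ p.1 p.2 * (v p.1 p.2 + μ (ρ p.1 p.2) / ρ p.1 p.2 ^ 2 * ρx p) ^ 2)
    (g := fun p => -2 * ((v p.1 p.2 + μ (ρ p.1 p.2) / ρ p.1 p.2 ^ 2 * ρx p) *
      (deriv P (ρ p.1 p.2) * ρx p)))
    (cρ.mul (cw.pow 2)) (continuousOn_const.mul (cw.mul (cP'.mul cρx)))
    (fun p hpΩ => by
      have hpL := openDomain_subset_lateralDomain a b hpΩ
      obtain ⟨L, h1, h2, h3⟩ := hp.hasFDerivAt_ρ p hpΩ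
      obtain ⟨L', h4, h5⟩ := hp.effective_velocity p hpΩ
      refine ⟨_, h1.mul (h4.pow 2), ?_⟩
      have hm := hp.mass p hpL
      have e : ρt p = -(ρx p * v p.1 p.2 + ρ p.1 p.2 * vx p) := by linarith
      simp only [smul_apply, add_apply, h2, h3, smul_eq_mul, e, Function.uncurry]
      simp only [nsmul_eq_mul, Nat.cast_ofNat, Nat.add_one_sub_one, pow_one]
      linear_combination 2 * (v p.1 p.2 + μ (ρ p.1 p.2) / ρ p.1 p.2 ^ 2 * ρx p) * h5) ht
  have hU := h.hasDerivAt_U hH hρs hp ht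
  have hab := h.a_lt_b t ht.le
  have hprof := h.isProfile hp ht.le
  have hparts := intervalIntegral.integral_eq_sub_of_hasDerivAt_of_le hab.le
    (f := fun x => v t x * (P (ρ t x) - P ρs))
    (f' := fun x => vx (t, x) * (P (ρ t x) - P ρs) + v t x * (deriv P (ρ t x) * ρx (t, x)))
    (continuousOn_slice (cv.mul (cP.sub continuousOn_const)) ht)
    (fun x hx => by
      obtain ⟨L', h4, h5, h6⟩ := hp.hasFDerivAt_v (t, x) ⟨ht, hx⟩
      have := hasDerivAt_slice h4
      rw [h6] at this
      exact this.mul ((HasDerivAt.comp (h := ρ t) x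
        (hH.hasDerivAt_P (hprof.pos x (Ioo_subset_Icc_self hx)))
        (hprof.hasDerivAt_ρ x hx)).sub_const _))
    (h.intervalIntegrable_slice ((cvx.mul (cP.sub continuousOn_const)).add
      (cv.mul (cP'.mul cρx))) ht)
  -- Along a piston $k(\rho)$ has derivative $(\mu/\rho)(-\rho v_x)=-\mu v_x$, which removes the
  -- viscous stress from Newton's law.
  have hka := HasDerivAt.comp (h := fun s => ρ s (a s)) t
    (hH.hasDerivAt_k hρs (hprof.pos (a t) (left_mem_Icc.2 hab.le))) (hp.hasDerivAt_ρ_a t ht)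
  have hkb := HasDerivAt.comp (h := fun s => ρ s (b s)) t
    (hH.hasDerivAt_k hρs (hprof.pos (b t) (right_mem_Icc.2 hab.le))) (hp.hasDerivAt_ρ_b t ht)
  have hva := (((hp.hasDerivAt_v_a t ht).add hka).pow 2).const_mul (1 / 2)
  have hvb := (((hp.hasDerivAt_v_b t ht).sub hkb).pow 2).const_mul (1 / 2)
  have hall := (((hkin.const_mul (1 / 2)).add hvb).add hva).add hU
  refine (hall.congr_of_eventuallyEq ?_).congr_deriv ?_
  · filter_upwards [Ioi_mem_nhds ht] with s hs
    exact W_eq hH hρs (h.isProfile hp (le_of_lt hs))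
  have i1 : IntervalIntegrable (fun x => vx (t, x) * (P (ρ t x) - P ρs)) volume (a t) (b t) :=
    h.intervalIntegrable_slice (cvx.mul (cP.sub continuousOn_const)) ht
  have i2 : IntervalIntegrable (fun x => v t x * (deriv P (ρ t x) * ρx (t, x))) volume (a t) (b t) :=
    h.intervalIntegrable_slice (cv.mul (cP'.mul cρx)) ht
  have i3 : IntervalIntegrable
      (fun x => μ (ρ t x) / ρ t x ^ 2 * deriv P (ρ t x) * ρx (t, x) ^ 2) volume (a t) (b t) :=
    h.intervalIntegrable_slice ((cφ.mul cP').mul (cρx.pow 2)) ht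
  have j1 := intervalIntegral.integral_add (μ := volume) i1 i2
  have j2 : ∫ x in (a t)..(b t), -2 * ((v t x + μ (ρ t x) / ρ t x ^ 2 * ρx (t, x)) *
      (deriv P (ρ t x) * ρx (t, x))) =
      -2 * ((∫ x in (a t)..(b t), v t x * (deriv P (ρ t x) * ρx (t, x))) +
        ∫ x in (a t)..(b t), μ (ρ t x) / ρ t x ^ 2 * deriv P (ρ t x) * ρx (t, x) ^ 2) := by
    rw [intervalIntegral.integral_const_mul, ← intervalIntegral.integral_add i2 i3]
    congr 1
    exact intervalIntegral.integral_congr fun x _ => by ring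
  have j3 : ∫ x in (a t)..(b t), -((P (ρ t x) - P ρs) * vx (t, x)) =
      - ∫ x in (a t)..(b t), vx (t, x) * (P (ρ t x) - P ρs) := by
    rw [← intervalIntegral.integral_neg]
    exact intervalIntegral.integral_congr fun x _ => by ring
  have ha0 := hprof.pos (a t) (left_mem_Icc.2 hab.le)
  have hb0 := hprof.pos (b t) (right_mem_Icc.2 hab.le)
  simp only at j1 j2 j3 hparts ⊢
  rw [j3, j2]
  rw [j1] at hparts
  rw [← hP]
  generalize (∫ x in (a t)..(b t), v t x * (deriv P (ρ t x) * ρx (t, x))) = I₁ at hparts ⊢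
  generalize (∫ x in (a t)..(b t), vx (t, x) * (P (ρ t x) - P ρs)) = I₂ at hparts ⊢
  generalize (∫ x in (a t)..(b t), μ (ρ t x) / ρ t x ^ 2 * deriv P (ρ t x) * ρx (t, x) ^ 2) = I₃
  simp only [Pi.add_apply, Pi.sub_apply, Function.comp]
  norm_num
  field_simp
  linear_combination (-1) * hparts

end Rates

/-! ### One-dimensional Sobolev inequalities. -/

/-- Cauchy–Schwarz against the constant $1$, read off from $\int((b-a)f-I)^2\ge0$. -/
lemma sq_integral_le {f : ℝ → ℝ} {a b : ℝ} (hab : a < b) (hf : ContinuousOn f (Icc a b)) :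
    (∫ x in a..b, f x) ^ 2 ≤ (b - a) * ∫ x in a..b, f x ^ 2 := by
  set I := ∫ x in a..b, f x with hI
  have hl : 0 < b - a := sub_pos.2 hab
  have i1 : IntervalIntegrable f volume a b := hf.intervalIntegrable_of_Icc hab.le
  have i2 : IntervalIntegrable (fun x => f x ^ 2) volume a b :=
    (hf.pow 2).intervalIntegrable_of_Icc hab.le
  have h0 : 0 ≤ ∫ x in a..b, ((b - a) * f x - I) ^ 2 :=
    intervalIntegral.integral_nonneg hab.le fun x _ => sq_nonneg _
  have h1 : ∫ x in a..b, ((b - a) * f x - I) ^ 2 =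
      (b - a) ^ 2 * (∫ x in a..b, f x ^ 2) - 2 * (b - a) * I * I + I ^ 2 * (b - a) := by
    have e : ∀ x, ((b - a) * f x - I) ^ 2 =
      (b - a) ^ 2 * f x ^ 2 - 2 * (b - a) * I * f x + I ^ 2 := fun x => by ring
    simp only [e]
    rw [intervalIntegral.integral_add ((i2.const_mul _).sub (i1.const_mul _)) (by simp),
      intervalIntegral.integral_sub (i2.const_mul _) (i1.const_mul _),
      intervalIntegral.integral_const_mul, intervalIntegral.integral_const_mul, ← hI]
    simp
    ring
  rw [h1] at h0
  have : 0 ≤ (b - a) * ((b - a) * (∫ x in a..b, f x ^ 2) - I ^ 2) := by linarith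
  have := nonneg_of_mul_nonneg_right this hl
  linarith

lemma abs_sub_le_integral {f f' g : ℝ → ℝ} {a b : ℝ} (hf : ContinuousOn f (Icc a b))
    (hf' : ∀ x ∈ Ioo a b, HasDerivAt f (f' x) x) (hc : ContinuousOn f' (Icc a b))
    (hg : ContinuousOn g (Icc a b)) (hg0 : ∀ x ∈ Icc a b, |f' x| ≤ g x) {x y : ℝ}
    (hx : x ∈ Icc a b) (hy : y ∈ Icc a b) : |f x - f y| ≤ ∫ z in a..b, g z := by
  wlog hxy : y ≤ x generalizing x y
  · rw [abs_sub_comm]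
    exact this hy hx (le_of_not_ge hxy)
  have hsub : Icc y x ⊆ Icc a b := Icc_subset_Icc hy.1 hx.2
  have h1 := intervalIntegral.integral_eq_sub_of_hasDerivAt_of_le hxy (hf.mono hsub)
    (fun z hz => hf' z (Ioo_subset_Ioo hy.1 hx.2 hz)) ((hc.mono hsub).intervalIntegrable_of_Icc hxy)
  rw [← h1]
  refine (intervalIntegral.abs_integral_le_integral_abs hxy).trans ?_
  refine (intervalIntegral.integral_mono_on hxy
    ((hc.mono hsub).abs.intervalIntegrable_of_Icc hxy)
    ((hg.mono hsub).intervalIntegrable_of_Icc hxy) fun z hz => hg0 z (hsub hz)).trans ?_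
  refine intervalIntegral.integral_mono_interval hy.1 hxy hx.2 ?_
    (hg.intervalIntegrable_of_Icc (hx.1.trans hx.2))
  refine (ae_restrict_iff' measurableSet_Ioc).2 (Eventually.of_forall fun z hz => ?_)
  exact (abs_nonneg _).trans (hg0 z (Ioc_subset_Icc_self hz))

lemma sq_sub_le_mul_integral {f f' : ℝ → ℝ} {a b : ℝ} (hf : ContinuousOn f (Icc a b))
    (hf' : ∀ x ∈ Ioo a b, HasDerivAt f (f' x) x) (hc : ContinuousOn f' (Icc a b)) (hab : a < b)
    {x y : ℝ} (hx : x ∈ Icc a b) (hy : y ∈ Icc a b) :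
    (f x - f y) ^ 2 ≤ (b - a) * ∫ z in a..b, f' z ^ 2 := by
  have h := abs_sub_le_integral hf hf' hc hc.abs (fun _ _ => le_rfl) hx hy
  have h2 := sq_integral_le hab hc.abs
  simp only [sq_abs] at h2
  calc (f x - f y) ^ 2 = |f x - f y| ^ 2 := (sq_abs _).symm
    _ ≤ _ := pow_le_pow_left₀ (abs_nonneg _) h 2
    _ ≤ _ := h2

/-! ### Confinement of the density to a compact subset of $(0,\infty)$. -/

namespace AssumptionH

variable {P μ : ℝ → ℝ}

lemma continuousOn_G_deriv (hH : AssumptionH P μ) {ρs : ℝ} (hρs : 0 < ρs) :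
    ContinuousOn (fun l => μ l / l ^ (3 / 2 : ℝ) * √(Q P ρs l)) (Ioi 0) := by
  refine (hH.continuousOn_μ.div ?_ fun l hl => (Real.rpow_pos_of_pos hl _).ne').mul
    (hH.continuousOn_Q hρs).sqrt
  exact continuousOn_id.rpow_const fun l hl => Or.inl (ne_of_gt hl)

lemma hasDerivAt_G (hH : AssumptionH P μ) {ρs r : ℝ} (hρs : 0 < ρs) (hr : 0 < r) :
    HasDerivAt (G P μ ρs) (μ r / r ^ (3 / 2 : ℝ) * √(Q P ρs r)) r :=
  hasDerivAt_integral (hH.continuousOn_G_deriv hρs) hρs hr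

lemma monotoneOn_G (hH : AssumptionH P μ) {ρs : ℝ} (hρs : 0 < ρs) :
    MonotoneOn (G P μ ρs) (Ioi 0) := by
  refine monotoneOn_of_deriv_nonneg (convex_Ioi 0)
    (fun _ hr => (hH.hasDerivAt_G hρs hr).continuousAt.continuousWithinAt) ?_ ?_
  · intro r hr
    rw [interior_Ioi] at hr
    exact (hH.hasDerivAt_G hρs hr).differentiableAt.differentiableWithinAt
  · intro r hr
    rw [interior_Ioi] at hr
    rw [(hH.hasDerivAt_G hρs hr).deriv]
    have := (hH.μ_pos r hr).le
    have hr : (0 : ℝ) < r := hr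
    positivity

/-- The potential energy density stays away from zero near the vacuum. -/
lemma exists_le_Q (hH : AssumptionH P μ) {ρs : ℝ} (hρs : 0 < ρs) :
    ∃ δ, 0 < δ ∧ ∀ r, 0 < r → r ≤ ρs / 4 → δ ≤ Q P ρs r := by
  have hh : 0 < ρs / 2 := by linarith
  have hδ : 0 < P ρs - P (ρs / 2) :=
    sub_pos.2 (hH.strictMonoOn_P hh hρs (by linarith : ρs / 2 < ρs))
  set δ := P ρs - P (ρs / 2) with hδd
  -- On $[r,\rho^*/2]$ the integrand is at least $\delta/\tau^2$, so $Q(r)\ge\delta(1-2r/\rho^*)$,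
  -- which is at least $\delta/2$ for $r\le\rho^*/4$.
  refine ⟨δ / 2, by linarith, fun r hr hr4 => ?_⟩
  have hr2 : r ≤ ρs / 2 := by linarith
  have hr2' : r ≤ ρs := by linarith
  have hc : ContinuousOn (fun τ => (P ρs - P τ) / τ ^ 2) (Ioi 0) :=
    (continuousOn_const.sub hH.continuousOn_P).div (continuousOn_pow 2)
      fun _ hx => pow_ne_zero 2 (ne_of_gt hx)
  have hc' : ContinuousOn (fun τ => (P τ - P ρs) / τ ^ 2) (Ioi 0) :=
    (hH.continuousOn_P.sub continuousOn_const).div (continuousOn_pow 2)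
      fun _ hx => pow_ne_zero 2 (ne_of_gt hx)
  have hpos : ∀ {x y z : ℝ}, 0 < x → z ∈ Icc x y → z ∈ Ioi (0 : ℝ) :=
    fun hx hz => lt_of_lt_of_le hx hz.1
  have h1 : Q P ρs r = r * ∫ τ in r..ρs, (P ρs - P τ) / τ ^ 2 := by
    rw [hH.Q_eq hρs hr, intervalIntegral.integral_symm, ← intervalIntegral.integral_neg]
    congr 1
    exact intervalIntegral.integral_congr fun x _ => by ring
  have h2 : ∫ τ in r..(ρs / 2), (P ρs - P τ) / τ ^ 2 ≤ ∫ τ in r..ρs, (P ρs - P τ) / τ ^ 2 := by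
    refine intervalIntegral.integral_mono_interval le_rfl hr2 (by linarith) ?_
      ((hc.mono fun z hz => hpos hr hz).intervalIntegrable_of_Icc hr2')
    refine (ae_restrict_iff' measurableSet_Ioc).2 (Eventually.of_forall fun z hz => ?_)
    have hz0 : z ∈ Ioi (0 : ℝ) := lt_trans hr hz.1
    have := hH.strictMonoOn_P.monotoneOn hz0 hρs hz.2
    exact div_nonneg (by linarith) (sq_nonneg z)
  have h3 : ∫ τ in r..(ρs / 2), δ / τ ^ 2 ≤ ∫ τ in r..(ρs / 2), (P ρs - P τ) / τ ^ 2 := by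
    refine intervalIntegral.integral_mono_on hr2 ?_
      ((hc.mono fun z hz => hpos hr hz).intervalIntegrable_of_Icc hr2) fun z hz => ?_
    · exact (ContinuousOn.div continuousOn_const (continuousOn_pow 2)
        fun z hz => pow_ne_zero 2 (ne_of_gt (hpos hr hz))).intervalIntegrable_of_Icc hr2
    · have hz0 := hpos hr hz
      have := hH.strictMonoOn_P.monotoneOn hz0 hh hz.2
      exact div_le_div_of_nonneg_right (by linarith) (sq_nonneg z)
  have h4 : ∫ τ in r..(ρs / 2), δ / τ ^ 2 = δ / r - δ / (ρs / 2) := by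
    have hd : ∀ x ∈ uIcc r (ρs / 2), HasDerivAt (fun x => -(δ / x)) (δ / x ^ 2) x := fun x hx => by
      rw [uIcc_of_le hr2] at hx
      have hx0 : x ≠ 0 := ne_of_gt (hpos hr hx)
      have := (((hasDerivAt_inv hx0).const_mul δ)).neg
      refine (this.congr_of_eventuallyEq (Eventually.of_forall fun y => ?_)).congr_deriv ?_
      · simp [div_eq_mul_inv]
      · field_simp
    rw [intervalIntegral.integral_eq_sub_of_hasDerivAt hd]
    · ring
    · exact (ContinuousOn.div continuousOn_const (continuousOn_pow 2)
        fun z hz => pow_ne_zero 2 (ne_of_gt (hpos hr hz))).intervalIntegrable_of_Icc hr2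
  rw [h1]
  have h5 : δ / r - δ / (ρs / 2) ≤ ∫ τ in r..ρs, (P ρs - P τ) / τ ^ 2 := by linarith
  calc δ / 2 ≤ r * (δ / r - δ / (ρs / 2)) := by
        have : r * (δ / r - δ / (ρs / 2)) = δ - δ * (r / (ρs / 2)) := by field_simp
        rw [this]
        have h6 : r / (ρs / 2) ≤ 1 / 2 := by rw [div_le_iff₀ hh]; linarith
        nlinarith
    _ ≤ _ := mul_le_mul_of_nonneg_left h5 hr.le

end AssumptionH

namespace IsProfile

variable {P μ : ℝ → ℝ} {a b ρs : ℝ} {ρ ρx v : ℝ → ℝ}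

lemma continuousOn_comp (hp : IsProfile a b ρ ρx v) {F : ℝ → ℝ} (hF : ContinuousOn F (Ioi 0)) :
    ContinuousOn (fun x => F (ρ x)) (Icc a b) := hF.comp hp.continuousOn_ρ hp.pos

lemma integrable (hp : IsProfile a b ρ ρx v) {f : ℝ → ℝ} (hf : ContinuousOn f (Icc a b)) :
    IntervalIntegrable f volume a b := hf.intervalIntegrable_of_Icc hp.lt.le

lemma integral_mono (hp : IsProfile a b ρ ρx v) {f g : ℝ → ℝ} (hf : ContinuousOn f (Icc a b))
    (hg : ContinuousOn g (Icc a b)) (hfg : ∀ x ∈ Icc a b, f x ≤ g x) :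
    ∫ x in a..b, f x ≤ ∫ x in a..b, g x :=
  intervalIntegral.integral_mono_on hp.lt.le (hp.integrable hf) (hp.integrable hg) hfg

lemma U_nonneg (hH : AssumptionH P μ) (hρs : 0 < ρs) (hp : IsProfile a b ρ ρx v) :
    0 ≤ U P ρs a b ρ :=
  intervalIntegral.integral_nonneg hp.lt.le fun x hx => hH.Q_nonneg hρs (hp.pos x hx)

lemma kinetic_nonneg (hp : IsProfile a b ρ ρx v) : 0 ≤ ∫ x in a..b, ρ x * v x ^ 2 :=
  intervalIntegral.integral_nonneg hp.lt.le fun x hx => mul_nonneg (hp.pos x hx).le (sq_nonneg _)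

lemma E_nonneg (hH : AssumptionH P μ) (hρs : 0 < ρs) (hp : IsProfile a b ρ ρx v) :
    0 ≤ E P ρs a b ρ v := by
  have h1 := hp.U_nonneg hH hρs
  have h2 := hp.kinetic_nonneg
  unfold E
  positivity

lemma effective_kinetic_nonneg (hp : IsProfile a b ρ ρx v) :
    0 ≤ ∫ x in a..b, ρ x * (v x + μ (ρ x) / ρ x ^ 2 * ρx x) ^ 2 :=
  intervalIntegral.integral_nonneg hp.lt.le fun x hx => mul_nonneg (hp.pos x hx).le (sq_nonneg _)

lemma W_nonneg (hH : AssumptionH P μ) (hρs : 0 < ρs) (hp : IsProfile a b ρ ρx v) :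
    0 ≤ W P μ ρs a b ρ v := by
  have h1 := hp.U_nonneg hH hρs
  have h2 := hp.effective_kinetic_nonneg (μ := μ)
  rw [W_eq hH hρs hp]
  positivity

lemma continuousOn_φ (hH : AssumptionH P μ) (hp : IsProfile a b ρ ρx v) :
    ContinuousOn (fun x => μ (ρ x) / ρ x ^ 2) (Icc a b) :=
  hp.continuousOn_comp (hH.continuousOn_μ.div (continuousOn_pow 2)
    fun _ hx => pow_ne_zero 2 (ne_of_gt hx))

/-- The energy of the density gradient is controlled by `W` and `E`. -/
lemma integral_gradient_le (hH : AssumptionH P μ) (hρs : 0 < ρs) (hp : IsProfile a b ρ ρx v) :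
    ∫ x in a..b, ρ x * (μ (ρ x) / ρ x ^ 2 * ρx x) ^ 2
      ≤ 4 * W P μ ρs a b ρ v + 4 * E P ρs a b ρ v := by
  have cφ := hp.continuousOn_φ hH
  have cρ := hp.continuousOn_ρ
  have cv := hp.continuousOn_v
  have c1 : ContinuousOn (fun x => ρ x * (v x + μ (ρ x) / ρ x ^ 2 * ρx x) ^ 2) (Icc a b) :=
    cρ.mul ((cv.add (cφ.mul hp.continuousOn_ρx)).pow 2)
  have c2 : ContinuousOn (fun x => ρ x * v x ^ 2) (Icc a b) := cρ.mul (cv.pow 2)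
  have h1 := hp.integral_mono (cρ.mul ((cφ.mul hp.continuousOn_ρx).pow 2))
    ((continuousOn_const (c := 2)).mul (c1.add c2)) (fun x hx => by
      have := hp.pos x hx
      simp only [Pi.mul_apply, Pi.pow_apply, Pi.add_apply]
      -- With $A=\mu\rho_x/\rho^2$ this square is $2(v+A)^2+2v^2-A^2$.
      have h3 := sq_nonneg (2 * v x + μ (ρ x) / ρ x ^ 2 * ρx x)
      nlinarith)
  have h2 : ∫ x in a..b, 2 * (ρ x * (v x + μ (ρ x) / ρ x ^ 2 * ρx x) ^ 2 + ρ x * v x ^ 2) =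
      2 * ((∫ x in a..b, ρ x * (v x + μ (ρ x) / ρ x ^ 2 * ρx x) ^ 2)
        + ∫ x in a..b, ρ x * v x ^ 2) := by
    rw [intervalIntegral.integral_const_mul,
      intervalIntegral.integral_add (hp.integrable c1) (hp.integrable c2)]
  have hU := hp.U_nonneg hH hρs
  rw [W_eq hH hρs hp, E]
  have e1 := sq_nonneg (v a)
  have e2 := sq_nonneg (v b)
  have e3 := sq_nonneg (v b - k μ ρs (ρ b))
  have e4 := sq_nonneg (v a + k μ ρs (ρ a))
  refine (h1.trans (le_of_eq h2)).trans ?_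
  linarith

/-- The value $k(\rho(b))$ is the difference of $v(b)$, controlled by $E$, and $v(b)-k(\rho(b))$,
controlled by $W$. Since $k\to+\infty$, this bounds $\rho(b)$ from above. -/
lemma k_sq_le (hH : AssumptionH P μ) (hρs : 0 < ρs) (hp : IsProfile a b ρ ρx v) :
    k μ ρs (ρ b) ^ 2 ≤ 4 * W P μ ρs a b ρ v + 4 * E P ρs a b ρ v := by
  have hU := hp.U_nonneg hH hρs
  have h1 := hp.effective_kinetic_nonneg (μ := μ)
  have h2 := hp.kinetic_nonneg
  rw [W_eq hH hρs hp, E]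
  have e1 := sq_nonneg (v a)
  have e4 := sq_nonneg (v a + k μ ρs (ρ a))
  have e5 := sq_nonneg (k μ ρs (ρ b) - 2 * v b)
  nlinarith

/-- The oscillation of `G(ρ)` is controlled by `W` and `E`. -/
lemma abs_G_sub_le (hH : AssumptionH P μ) (hρs : 0 < ρs) (hp : IsProfile a b ρ ρx v) {x y : ℝ}
    (hx : x ∈ Icc a b) (hy : y ∈ Icc a b) :
    |G P μ ρs (ρ x) - G P μ ρs (ρ y)| ≤ 2 * W P μ ρs a b ρ v + 3 * E P ρs a b ρ v := by
  have cφ := hp.continuousOn_φ hH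
  have cρ := hp.continuousOn_ρ
  have cQ := hp.continuousOn_comp (hH.continuousOn_Q hρs)
  have cA : ContinuousOn (fun x => ρ x * (μ (ρ x) / ρ x ^ 2 * ρx x) ^ 2) (Icc a b) :=
    cρ.mul ((cφ.mul hp.continuousOn_ρx).pow 2)
  have h := abs_sub_le_integral (f := fun x => G P μ ρs (ρ x))
    (f' := fun x => μ (ρ x) / ρ x ^ (3 / 2 : ℝ) * √(Q P ρs (ρ x)) * ρx x)
    (g := fun x => 1 / 2 * (ρ x * (μ (ρ x) / ρ x ^ 2 * ρx x) ^ 2 + Q P ρs (ρ x)))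
    (hp.continuousOn_comp fun _ hr =>
      (hH.hasDerivAt_G hρs hr).continuousAt.continuousWithinAt)
    (fun x hx => HasDerivAt.comp (h := ρ) x
      (hH.hasDerivAt_G hρs (hp.pos x (Ioo_subset_Icc_self hx))) (hp.hasDerivAt_ρ x hx))
    ((hp.continuousOn_comp (hH.continuousOn_G_deriv hρs)).mul hp.continuousOn_ρx)
    (continuousOn_const.mul (cA.add cQ)) (fun x hx => by
      have hpos := hp.pos x hx
      have hr : ρ x ^ (3 / 2 : ℝ) = ρ x * √(ρ x) := by
        rw [show (3 / 2 : ℝ) = 1 + 1 / 2 by norm_num, Real.rpow_add hpos, Real.rpow_one,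
          ← Real.sqrt_eq_rpow]
      set s := √(ρ x) with hs
      have hs0 : 0 < s := Real.sqrt_pos.2 hpos
      have hss : ρ x = s ^ 2 := (Real.sq_sqrt hpos.le).symm
      set q := √(Q P ρs (ρ x)) with hq
      have hqq : Q P ρs (ρ x) = q ^ 2 := (Real.sq_sqrt (hH.Q_nonneg hρs hpos)).symm
      -- The weight in $G$ factors $G(\rho)_x$ into $\sqrt\rho\,\mu\rho_x/\rho^2$ times $\sqrt{Q}$.
      -- The arithmetic-geometric inequality splits the product into the gradient energy and the
      -- potential energy.
      have e : μ (ρ x) / (ρ x * s) * q * ρx x = (s * (μ (ρ x) / ρ x ^ 2 * ρx x)) * q := by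
        generalize μ (ρ x) = m
        rw [hss]
        field_simp
      have e2 : ρ x * (μ (ρ x) / ρ x ^ 2 * ρx x) ^ 2 = (s * (μ (ρ x) / ρ x ^ 2 * ρx x)) ^ 2 := by
        rw [mul_pow s, ← hss]
      rw [hr, e, e2, hqq]
      generalize s * (μ (ρ x) / ρ x ^ 2 * ρx x) = A
      rw [abs_le]
      constructor <;> nlinarith [sq_nonneg (A + q), sq_nonneg (A - q)]) hx hy
  have e : ∫ x in a..b, 1 / 2 * (ρ x * (μ (ρ x) / ρ x ^ 2 * ρx x) ^ 2 + Q P ρs (ρ x)) =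
      1 / 2 * ((∫ x in a..b, ρ x * (μ (ρ x) / ρ x ^ 2 * ρx x) ^ 2) + U P ρs a b ρ) := by
    rw [intervalIntegral.integral_const_mul,
      intervalIntegral.integral_add (hp.integrable cA) (hp.integrable cQ), U]
  rw [e] at h
  have h1 := hp.integral_gradient_le hH hρs
  have h2 : U P ρs a b ρ ≤ E P ρs a b ρ v := by
    have h2 := hp.kinetic_nonneg
    unfold E
    nlinarith [sq_nonneg (v a), sq_nonneg (v b)]
  have h3 := hp.E_nonneg hH hρs
  refine h.trans ?_
  linarith

/-- Bounds on `W` and `E` confine the density to a compact subset of `(0, ∞)`. -/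
lemma exists_density_bounds (hH : AssumptionH P μ) (hρs : 0 < ρs) (C : ℝ) :
    ∃ m M, 0 < m ∧ m ≤ ρs ∧ ρs ≤ M ∧ ∀ (a b : ℝ) (ρ ρx v : ℝ → ℝ), IsProfile a b ρ ρx v →
      W P μ ρs a b ρ v ≤ C → E P ρs a b ρ v ≤ C → ∀ x ∈ Icc a b, ρ x ∈ Icc m M := by
  obtain ⟨δ, hδ, hQ⟩ := hH.exists_le_Q hρs
  -- If $\rho<\varepsilon$ everywhere, unit mass forces $b-a\ge1/\varepsilon$, hence
  -- $U\ge\delta/\varepsilon\ge|C|+1$, contradicting $E\le C$.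
  set ε := min (ρs / 4) (δ / (|C| + 1)) with hε
  have hC1 : 0 < |C| + 1 := by positivity
  have hε0 : 0 < ε := lt_min (by linarith) (by positivity)
  -- Here $k^2\le4W+4E\le8|C|$, which excludes $k>8|C|+1$.
  obtain ⟨M₁, hM₁⟩ := ((eventually_gt_atTop (0 : ℝ)).and
    ((hH.tendsto_k_atTop ρs hρs).eventually_gt_atTop (8 * |C| + 1))).exists_forall_of_atTop
  have hM₁0 : 0 < M₁ := (hM₁ M₁ le_rfl).1
  obtain ⟨M₂, hM₂⟩ := (((hH.tendsto_G_atTop ρs hρs).eventually_gt_atTop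
    (G P μ ρs M₁ + 5 * |C|))).exists_forall_of_atTop
  obtain ⟨m, hm0, hm⟩ := (mem_nhdsGT_iff_exists_Ioo_subset).1
    ((hH.tendsto_G_zero ρs hρs).eventually_lt_atBot (G P μ ρs ε - 5 * |C|))
  have hm0 : 0 < m := hm0
  refine ⟨min m ρs, max M₂ ρs, lt_min hm0 hρs, min_le_right _ _, le_max_right _ _,
    fun a b ρ ρx v hp hW hE x hx => ?_⟩
  have hCa := le_abs_self C
  -- The oscillation of $G(\rho)$ transfers the upper bound at $b$ and the lower bound $\varepsilon$
  -- at some point to the whole interval.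
  have hosc : ∀ x ∈ Icc a b, ∀ y ∈ Icc a b,
      |G P μ ρs (ρ x) - G P μ ρs (ρ y)| ≤ 5 * |C| := fun x hx y hy =>
    (hp.abs_G_sub_le hH hρs hx hy).trans (by linarith)
  have hpos := hp.pos x hx
  have hb : b ∈ Icc a b := right_mem_Icc.2 hp.lt.le
  have hρb : ρ b < M₁ := by
    by_contra hcon
    have h1 := (hM₁ _ (not_lt.1 hcon)).2
    have h2 := hp.k_sq_le hH hρs
    nlinarith [abs_nonneg C]
  have hx0 : ∃ x0 ∈ Icc a b, ε ≤ ρ x0 := by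
    by_contra hcon
    push Not at hcon
    have h1 : ∫ x in a..b, ρ x ≤ ∫ _x in a..b, ε :=
      hp.integral_mono hp.continuousOn_ρ continuousOn_const fun x hx => (hcon x hx).le
    have h2 : ∫ _x in a..b, δ ≤ U P ρs a b ρ :=
      hp.integral_mono continuousOn_const (hp.continuousOn_comp (hH.continuousOn_Q hρs))
        fun x hx => hQ _ (hp.pos x hx) ((hcon x hx).le.trans (min_le_left _ _))
    rw [hp.total_mass] at h1
    simp only [intervalIntegral.integral_const, smul_eq_mul] at h1 h2
    have h3 : U P ρs a b ρ ≤ E P ρs a b ρ v := by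
      have h2 := hp.kinetic_nonneg
      unfold E
      nlinarith [sq_nonneg (v a), sq_nonneg (v b)]
    have h4 : ε * (|C| + 1) ≤ δ := by
      have := min_le_right (ρs / 4) (δ / (|C| + 1))
      rwa [← hε, le_div_iff₀ hC1] at this
    have hl := sub_pos.2 hp.lt
    have h5 : (b - a) * (ε * (|C| + 1)) ≤ |C| := by
      calc (b - a) * (ε * (|C| + 1)) ≤ (b - a) * δ := mul_le_mul_of_nonneg_left h4 hl.le
        _ ≤ |C| := by linarith
    nlinarith
  obtain ⟨x0, hx0, hεx0⟩ := hx0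
  constructor
  · refine (min_le_left _ _).trans ?_
    by_contra hcon
    have h1 : G P μ ρs (ρ x) < G P μ ρs ε - 5 * |C| := hm ⟨hpos, not_le.1 hcon⟩
    have h2 := hH.monotoneOn_G hρs hε0 (hp.pos x0 hx0) hεx0
    have h3 := (abs_le.1 (hosc x hx x0 hx0)).1
    linarith
  · refine le_trans ?_ (le_max_left _ _)
    by_contra hcon
    have h1 := hM₂ _ (not_le.1 hcon).le
    have h2 := hH.monotoneOn_G hρs (hp.pos b hb) hM₁0 hρb.le
    have h3 := (abs_le.1 (hosc x hx b hb)).2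
    linarith

end IsProfile

/-! ### Comparison of the constitutive functions with $\rho-\rho^*$. -/

/-- A mean value theorem valid on both sides of $s$ and at $s$. Writing $k$ and $P-P(\rho^*)$ as
positive multiples of $r-\rho^*$ makes their product comparable to a square. -/
lemma exists_slope {f f' : ℝ → ℝ} {m M c C s r : ℝ}
    (hf : ∀ x ∈ Icc m M, HasDerivAt f (f' x) x) (hf' : ∀ x ∈ Icc m M, f' x ∈ Icc c C)
    (hs : s ∈ Icc m M) (hr : r ∈ Icc m M) : ∃ α ∈ Icc c C, f r - f s = α * (r - s) := by
  have key : ∀ x ∈ Icc m M, ∀ y ∈ Icc m M, x < y → ∃ α ∈ Icc c C, f y - f x = α * (y - x) := by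
    intro x hx y hy hxy
    have hsub : Icc x y ⊆ Icc m M := Icc_subset_Icc hx.1 hy.2
    obtain ⟨ξ, hξ, h⟩ := exists_hasDerivAt_eq_slope f f' hxy
      (fun z hz => (hf z (hsub hz)).continuousAt.continuousWithinAt)
      (fun z hz => hf z (hsub (Ioo_subset_Icc_self hz)))
    refine ⟨f' ξ, hf' ξ (hsub (Ioo_subset_Icc_self hξ)), ?_⟩
    rw [h, div_mul_cancel₀ _ (sub_pos.2 hxy).ne']
  rcases lt_trichotomy s r with h | h | h
  · exact key s hs r hr h
  · exact ⟨f' s, hf' s hs, by rw [h]; ring⟩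
  · obtain ⟨α, hα, e⟩ := key r hr s hs h
    exact ⟨α, hα, by linarith⟩

lemma exists_pos_bounds {F : ℝ → ℝ} (hF : ContinuousOn F (Ioi 0)) (hF0 : ∀ r, 0 < r → 0 < F r)
    {m M : ℝ} (hm : 0 < m) (hmM : m ≤ M) :
    ∃ c C, 0 < c ∧ 0 < C ∧ ∀ r ∈ Icc m M, F r ∈ Icc c C := by
  have hsub : Icc m M ⊆ Ioi 0 := fun x hx => lt_of_lt_of_le hm hx.1
  have hne : (Icc m M).Nonempty := nonempty_Icc.2 hmM
  obtain ⟨x, hx, hx'⟩ := isCompact_Icc.exists_isMinOn hne (hF.mono hsub)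
  obtain ⟨y, hy, hy'⟩ := isCompact_Icc.exists_isMaxOn hne (hF.mono hsub)
  exact ⟨F x, F y, hF0 x (hsub hx), hF0 y (hsub hy), fun r hr => ⟨hx' hr, hy' hr⟩⟩

/-- On `[m, M] ∋ ρ*` the constitutive functions are comparable to `r - ρ*`, with constants
`c` and `C`. -/
structure CoeffBounds (P μ : ℝ → ℝ) (ρs m M c C : ℝ) : Prop where
  m_pos : 0 < m
  le_M : m ≤ M
  c_pos : 0 < c
  C_pos : 0 < C
  le_μ : ∀ r ∈ Icc m M, c ≤ μ r
  φ_mem : ∀ r ∈ Icc m M, μ r / r ^ 2 ∈ Icc c C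
  le_deriv_P : ∀ r ∈ Icc m M, c ≤ deriv P r
  P_sub : ∀ r ∈ Icc m M, ∃ α ∈ Icc c C, P r - P ρs = α * (r - ρs)
  k_eq : ∀ r ∈ Icc m M, ∃ α ∈ Icc c C, k μ ρs r = α * (r - ρs)
  Q_le : ∀ r ∈ Icc m M, Q P ρs r ≤ C * (r - ρs) ^ 2

lemma AssumptionH.exists_coeffBounds {P μ : ℝ → ℝ} (hH : AssumptionH P μ) {ρs m M : ℝ}
    (hm : 0 < m) (hmρ : m ≤ ρs) (hρM : ρs ≤ M) : ∃ c C, CoeffBounds P μ ρs m M c C := by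
  have hρs : 0 < ρs := lt_of_lt_of_le hm hmρ
  have hmM := hmρ.trans hρM
  have hsub : Icc m M ⊆ Ioi 0 := fun x hx => lt_of_lt_of_le hm hx.1
  have hs : ρs ∈ Icc m M := ⟨hmρ, hρM⟩
  obtain ⟨c₁, C₁, hc₁, hC₁, h₁⟩ := exists_pos_bounds hH.continuousOn_μ hH.μ_pos hm hmM
  obtain ⟨c₂, C₂, hc₂, hC₂, h₂⟩ := exists_pos_bounds (F := fun r => μ r / r)
    (hH.continuousOn_μ.div continuousOn_id fun _ hx => ne_of_gt hx)
    (fun r hr => div_pos (hH.μ_pos r hr) hr) hm hmM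
  obtain ⟨c₃, C₃, hc₃, hC₃, h₃⟩ := exists_pos_bounds (F := fun r => μ r / r ^ 2)
    (hH.continuousOn_μ.div (continuousOn_pow 2) fun _ hx => pow_ne_zero 2 (ne_of_gt hx))
    (fun r hr => div_pos (hH.μ_pos r hr) (pow_pos hr 2)) hm hmM
  obtain ⟨c₄, C₄, hc₄, hC₄, h₄⟩ := exists_pos_bounds hH.continuousOn_deriv_P hH.deriv_P_pos hm hmM
  set c := min (min c₁ c₂) (min c₃ c₄) with hc
  have l₁ : c ≤ c₁ := (min_le_left _ _).trans (min_le_left _ _)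
  have l₂ : c ≤ c₂ := (min_le_left _ _).trans (min_le_right _ _)
  have l₃ : c ≤ c₃ := (min_le_right _ _).trans (min_le_left _ _)
  have l₄ : c ≤ c₄ := (min_le_right _ _).trans (min_le_right _ _)
  -- The last entry serves $Q$: a prefactor $r\le M$ and an integrand at most
  -- $(C_4/m^2)|\tau-\rho^*|$.
  set C := max (max C₂ C₃) (max C₄ (M * (C₄ / m ^ 2))) with hC
  have u₂ : C₂ ≤ C := (le_max_left _ _).trans (le_max_left _ _)
  have u₃ : C₃ ≤ C := (le_max_right _ _).trans (le_max_left _ _)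
  have u₄ : C₄ ≤ C := (le_max_left _ _).trans (le_max_right _ _)
  have u₅ : M * (C₄ / m ^ 2) ≤ C := (le_max_right _ _).trans (le_max_right _ _)
  have hP : ∀ r ∈ Icc m M, ∃ α ∈ Icc c₄ C₄, P r - P ρs = α * (r - ρs) := fun r hr =>
    exists_slope (fun x hx => hH.hasDerivAt_P (hsub hx)) h₄ hs hr
  refine ⟨c, C, hm, hmM, lt_min (lt_min hc₁ hc₂) (lt_min hc₃ hc₄), hC₂.trans_le u₂,
    fun r hr => l₁.trans (h₁ r hr).1, fun r hr => ⟨l₃.trans (h₃ r hr).1, (h₃ r hr).2.trans u₃⟩,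
    fun r hr => l₄.trans (h₄ r hr).1, fun r hr => ?_, fun r hr => ?_, fun r hr => ?_⟩
  · obtain ⟨α, hα, e⟩ := hP r hr
    exact ⟨α, ⟨l₄.trans hα.1, hα.2.trans u₄⟩, e⟩
  · obtain ⟨α, hα, e⟩ := exists_slope (fun x hx => hH.hasDerivAt_k hρs (hsub hx)) h₂ hs hr
    refine ⟨α, ⟨l₂.trans hα.1, hα.2.trans u₂⟩, ?_⟩
    rw [← e]
    simp [k]
  · have hr0 : 0 < r := hsub hr
    have hint : ‖∫ τ in ρs..r, (P τ - P ρs) / τ ^ 2‖ ≤ C₄ * |r - ρs| / m ^ 2 * |r - ρs| := by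
      refine intervalIntegral.norm_integral_le_of_norm_le_const fun τ hτ => ?_
      have hτ' := uIoc_subset_uIcc hτ
      have hτm : τ ∈ Icc m M := uIcc_subset_Icc hs hr hτ'
      obtain ⟨α, hα, e⟩ := hP τ hτm
      have h5 : |τ - ρs| ≤ |r - ρs| := abs_sub_left_of_mem_uIcc hτ'
      have hα0 : 0 < α := hc₄.trans_le hα.1
      rw [Real.norm_eq_abs, e, abs_div, abs_mul, abs_of_pos hα0, abs_of_nonneg (sq_nonneg τ)]
      exact div_le_div₀ (by positivity) (mul_le_mul hα.2 h5 (abs_nonneg _) hC₄.le)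
        (by positivity) (pow_le_pow_left₀ hm.le hτm.1 2)
    rw [hH.Q_eq hρs hr0]
    calc r * ∫ τ in ρs..r, (P τ - P ρs) / τ ^ 2
        ≤ r * (C₄ * |r - ρs| / m ^ 2 * |r - ρs|) :=
          mul_le_mul_of_nonneg_left ((le_abs_self _).trans hint) hr0.le
      _ ≤ M * (C₄ * |r - ρs| / m ^ 2 * |r - ρs|) :=
          mul_le_mul_of_nonneg_right hr.2 (by positivity)
      _ = M * (C₄ / m ^ 2) * (r - ρs) ^ 2 := by rw [← sq_abs (r - ρs)]; ring
      _ ≤ C * (r - ρs) ^ 2 := mul_le_mul_of_nonneg_right u₅ (sq_nonneg _)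

/-! ### Equivalence of $V$ with the deviation, and control by the dissipation. -/

/-- The square of a norm of the deviation from the equilibrium, in physical coordinates. -/
def deviation (ρs a b : ℝ) (ρ ρx v : ℝ → ℝ) : ℝ :=
  v a ^ 2 + v b ^ 2 + (∫ x in a..b, v x ^ 2) + (∫ x in a..b, ρx x ^ 2) + (ρ b - ρs) ^ 2

namespace IsProfile

variable {P μ : ℝ → ℝ} {a b ρs m M c C : ℝ} {ρ ρx v : ℝ → ℝ}

lemma integral_v_sq_nonneg (hp : IsProfile a b ρ ρx v) : 0 ≤ ∫ x in a..b, v x ^ 2 :=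
  intervalIntegral.integral_nonneg hp.lt.le fun _ _ => sq_nonneg _

lemma integral_ρx_sq_nonneg (hp : IsProfile a b ρ ρx v) : 0 ≤ ∫ x in a..b, ρx x ^ 2 :=
  intervalIntegral.integral_nonneg hp.lt.le fun _ _ => sq_nonneg _

lemma deviation_nonneg (hp : IsProfile a b ρ ρx v) : 0 ≤ deviation ρs a b ρ ρx v := by
  have h1 := hp.integral_v_sq_nonneg
  have h2 := hp.integral_ρx_sq_nonneg
  unfold deviation
  positivity

lemma terms_le_deviation (hp : IsProfile a b ρ ρx v) :
    v a ^ 2 ≤ deviation ρs a b ρ ρx v ∧ v b ^ 2 ≤ deviation ρs a b ρ ρx v ∧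
    (∫ x in a..b, v x ^ 2) ≤ deviation ρs a b ρ ρx v ∧
    (∫ x in a..b, ρx x ^ 2) ≤ deviation ρs a b ρ ρx v ∧
    (ρ b - ρs) ^ 2 ≤ deviation ρs a b ρ ρx v := by
  have h1 := hp.integral_v_sq_nonneg
  have h2 := hp.integral_ρx_sq_nonneg
  have h3 := sq_nonneg (v a)
  have h4 := sq_nonneg (v b)
  have h5 := sq_nonneg (ρ b - ρs)
  unfold deviation
  refine ⟨?_, ?_, ?_, ?_, ?_⟩ <;> linarith

lemma length_le (hp : IsProfile a b ρ ρx v) (hm : 0 < m) (hρ : ∀ x ∈ Icc a b, ρ x ∈ Icc m M) :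
    b - a ≤ 1 / m := by
  have h := hp.integral_mono continuousOn_const hp.continuousOn_ρ fun x hx => (hρ x hx).1
  rw [hp.total_mass] at h
  simp only [intervalIntegral.integral_const, smul_eq_mul] at h
  rwa [le_div_iff₀ hm]

lemma le_length (hp : IsProfile a b ρ ρx v) (hm : 0 < m) (hρ : ∀ x ∈ Icc a b, ρ x ∈ Icc m M) :
    1 / M ≤ b - a := by
  have h := hp.integral_mono hp.continuousOn_ρ continuousOn_const fun x hx => (hρ x hx).2
  rw [hp.total_mass] at h
  simp only [intervalIntegral.integral_const, smul_eq_mul] at h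
  have ha : a ∈ Icc a b := left_mem_Icc.2 hp.lt.le
  have hM : 0 < M := hm.trans_le ((hρ a ha).1.trans (hρ a ha).2)
  rwa [div_le_iff₀ hM]

/-- The gradient controls oscillation and $\rho(b)$ fixes the constant. Unit mass bounds the length
by $1/m$. -/
lemma sq_sub_le_deviation (hp : IsProfile a b ρ ρx v) (hm : 0 < m)
    (hρ : ∀ x ∈ Icc a b, ρ x ∈ Icc m M) {x : ℝ} (hx : x ∈ Icc a b) :
    (ρ x - ρs) ^ 2 ≤ (2 + 2 / m) * deviation ρs a b ρ ρx v := by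
  have h := sq_sub_le_mul_integral hp.continuousOn_ρ hp.hasDerivAt_ρ hp.continuousOn_ρx hp.lt
    hx (right_mem_Icc.2 hp.lt.le)
  have hl := hp.length_le hm hρ
  obtain ⟨-, -, -, hJ, hd⟩ := hp.terms_le_deviation (ρs := ρs)
  have hJ0 := hp.integral_ρx_sq_nonneg
  have h2 : (b - a) * (∫ x in a..b, ρx x ^ 2) ≤ 1 / m * deviation ρs a b ρ ρx v :=
    mul_le_mul hl hJ hJ0 (by positivity)
  have h3 : (2 + 2 / m) * deviation ρs a b ρ ρx v
      = 2 * deviation ρs a b ρ ρx v + 2 * (1 / m * deviation ρs a b ρ ρx v) := by ring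
  nlinarith [sq_nonneg ((ρ x - ρ b) - (ρ b - ρs))]

/-- Every term of $V$ is at most quadratic in the deviation. The constant is chosen before the
profile, so it is uniform in time and over solutions. -/
lemma V_le_deviation (hH : AssumptionH P μ) (hρs : 0 < ρs) (hB : CoeffBounds P μ ρs m M c C)
    {r : ℝ} (hr : 0 ≤ r) : ∃ K, 0 < K ∧ ∀ (a b : ℝ) (ρ ρx v : ℝ → ℝ), IsProfile a b ρ ρx v →
      (∀ x ∈ Icc a b, ρ x ∈ Icc m M) →
      V P μ ρs r a b ρ v ≤ K * deviation ρs a b ρ ρx v := by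
  have hm := hB.m_pos
  have hC := hB.C_pos
  have hM : 0 < M := hm.trans_le hB.le_M
  set o := 2 + 2 / m with ho
  have ho0 : 0 < o := by positivity
  set KU := 1 / m * (C * o) with hKU
  set KE := 1 + M / 2 + KU with hKE
  set KW := M * (1 + C ^ 2) + (1 + C ^ 2) + (1 + C ^ 2 * o) + KU with hKW
  have hKU0 : 0 < KU := by positivity
  refine ⟨KW + r * KE, by positivity, fun a b ρ ρx v hp hρ => ?_⟩
  set n := deviation ρs a b ρ ρx v with hn
  have hn0 : 0 ≤ n := hp.deviation_nonneg
  obtain ⟨hA, hBb, hI, hJ, hd⟩ := hp.terms_le_deviation (ρs := ρs)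
  rw [← hn] at hA hBb hI hJ hd
  have hl := hp.length_le hm hρ
  have hosc : ∀ x ∈ Icc a b, (ρ x - ρs) ^ 2 ≤ o * n := fun x hx => hp.sq_sub_le_deviation hm hρ hx
  have cv := hp.continuousOn_v
  have cρx := hp.continuousOn_ρx
  have hU : U P ρs a b ρ ≤ KU * n := by
    have h := hp.integral_mono (hp.continuousOn_comp (hH.continuousOn_Q hρs))
      (continuousOn_const (c := C * (o * n))) fun x hx =>
        (hB.Q_le _ (hρ x hx)).trans (mul_le_mul_of_nonneg_left (hosc x hx) hC.le)
    simp only [intervalIntegral.integral_const, smul_eq_mul] at h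
    refine h.trans ((mul_le_mul_of_nonneg_right hl (by positivity)).trans (le_of_eq ?_))
    rw [hKU]; ring
  have hkin : ∫ x in a..b, ρ x * v x ^ 2 ≤ M * n := by
    have h := hp.integral_mono (hp.continuousOn_ρ.mul (cv.pow 2))
      ((continuousOn_const (c := M)).mul (cv.pow 2)) fun x hx =>
        mul_le_mul_of_nonneg_right (hρ x hx).2 (sq_nonneg (v x))
    refine h.trans ?_
    have e : ∫ x in a..b, M * v x ^ 2 = M * ∫ x in a..b, v x ^ 2 :=
      intervalIntegral.integral_const_mul _ _
    exact (le_of_eq e).trans (mul_le_mul_of_nonneg_left hI hM.le)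
  have hekin : ∫ x in a..b, ρ x * (v x + μ (ρ x) / ρ x ^ 2 * ρx x) ^ 2
      ≤ 2 * (M * (1 + C ^ 2)) * n := by
    have c1 : ContinuousOn (fun x => v x ^ 2 + C ^ 2 * ρx x ^ 2) (Icc a b) :=
      (cv.pow 2).add (continuousOn_const.mul (cρx.pow 2))
    have h := hp.integral_mono (f := fun x => ρ x * (v x + μ (ρ x) / ρ x ^ 2 * ρx x) ^ 2)
      (g := fun x => 2 * M * (v x ^ 2 + C ^ 2 * ρx x ^ 2))
      (hp.continuousOn_ρ.mul ((cv.add ((hp.continuousOn_φ hH).mul cρx)).pow 2))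
      (continuousOn_const.mul c1) fun x hx => by
        obtain ⟨h1, h2⟩ := hB.φ_mem _ (hρ x hx)
        have hpos := hp.pos x hx
        have h0 := hB.c_pos
        generalize μ (ρ x) / ρ x ^ 2 = φ at h1 h2
        have h3 : φ ^ 2 ≤ C ^ 2 := pow_le_pow_left₀ (h0.le.trans h1) h2 2
        have h4 : (v x + φ * ρx x) ^ 2 ≤ 2 * (v x ^ 2 + C ^ 2 * ρx x ^ 2) := by
          nlinarith [sq_nonneg (v x - φ * ρx x),
            mul_le_mul_of_nonneg_right h3 (sq_nonneg (ρx x))]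
        calc ρ x * (v x + φ * ρx x) ^ 2 ≤ M * (2 * (v x ^ 2 + C ^ 2 * ρx x ^ 2)) :=
              mul_le_mul (hρ x hx).2 h4 (sq_nonneg _) hM.le
          _ = _ := by ring
    have e : ∫ x in a..b, 2 * M * (v x ^ 2 + C ^ 2 * ρx x ^ 2) =
        2 * M * ((∫ x in a..b, v x ^ 2) + C ^ 2 * ∫ x in a..b, ρx x ^ 2) := by
      have i1 : IntervalIntegrable (fun x => v x ^ 2) volume a b := hp.integrable (cv.pow 2)
      have i2 : IntervalIntegrable (fun x => C ^ 2 * ρx x ^ 2) volume a b :=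
        hp.integrable (continuousOn_const.mul (cρx.pow 2))
      rw [intervalIntegral.integral_const_mul, intervalIntegral.integral_add i1 i2,
        intervalIntegral.integral_const_mul]
    refine (h.trans (le_of_eq e)).trans ?_
    calc 2 * M * ((∫ x in a..b, v x ^ 2) + C ^ 2 * ∫ x in a..b, ρx x ^ 2)
        ≤ 2 * M * (n + C ^ 2 * n) := by gcongr
      _ = _ := by ring
  have hksq : ∀ x ∈ Icc a b, k μ ρs (ρ x) ^ 2 ≤ C ^ 2 * (ρ x - ρs) ^ 2 := fun x hx => by
    obtain ⟨α, hα, e⟩ := hB.k_eq _ (hρ x hx)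
    rw [e, mul_pow]
    exact mul_le_mul_of_nonneg_right
      (pow_le_pow_left₀ (hB.c_pos.le.trans hα.1) hα.2 2) (sq_nonneg _)
  have hb : (v b - k μ ρs (ρ b)) ^ 2 ≤ 2 * (1 + C ^ 2) * n := by
    have h1 := hksq b (right_mem_Icc.2 hp.lt.le)
    have h2 := mul_le_mul_of_nonneg_left hd (sq_nonneg C)
    nlinarith [sq_nonneg (v b + k μ ρs (ρ b))]
  have ha : (v a + k μ ρs (ρ a)) ^ 2 ≤ 2 * (1 + C ^ 2 * o) * n := by
    have h1 := hksq a (left_mem_Icc.2 hp.lt.le)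
    have h2 := mul_le_mul_of_nonneg_left (hosc a (left_mem_Icc.2 hp.lt.le)) (sq_nonneg C)
    nlinarith [sq_nonneg (v a - k μ ρs (ρ a))]
  have hE : E P ρs a b ρ v ≤ KE * n := by
    rw [E, hKE]; linarith
  have hW : W P μ ρs a b ρ v ≤ KW * n := by
    rw [W_eq hH hρs hp, hKW]; linarith
  rw [V]
  calc W P μ ρs a b ρ v + r * E P ρs a b ρ v ≤ KW * n + r * (KE * n) :=
        add_le_add hW (mul_le_mul_of_nonneg_left hE hr)
    _ = _ := by ring

/-- The velocities come from $E$, while the density gradient and $\rho(b)-\rho^*$ come from $W$ and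
$E$ jointly. This is where $r>0$ is needed. -/
lemma deviation_le_V (hH : AssumptionH P μ) (hρs : 0 < ρs) (hB : CoeffBounds P μ ρs m M c C)
    {r : ℝ} (hr : 0 < r) : ∃ K, 0 < K ∧ ∀ (a b : ℝ) (ρ ρx v : ℝ → ℝ), IsProfile a b ρ ρx v →
      (∀ x ∈ Icc a b, ρ x ∈ Icc m M) →
      deviation ρs a b ρ ρx v ≤ K * V P μ ρs r a b ρ v := by
  have hm := hB.m_pos
  have hc := hB.c_pos
  set Ks := 4 + 4 / r with hKs
  set K := 2 / r + 2 / r + 2 / m / r + Ks / (m * c ^ 2) + Ks / c ^ 2 with hK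
  refine ⟨K, by positivity, fun a b ρ ρx v hp hρ => ?_⟩
  have hE0 := hp.E_nonneg hH hρs
  have hW0 := hp.W_nonneg hH hρs
  have hU0 := hp.U_nonneg hH hρs
  have hkin0 := hp.kinetic_nonneg
  set Vv := V P μ ρs r a b ρ v with hV
  have hEV : E P ρs a b ρ v ≤ Vv / r := by
    rw [le_div_iff₀ hr, hV, V]; linarith
  have hWV : W P μ ρs a b ρ v ≤ Vv := by
    rw [hV, V]; nlinarith
  have hs : 4 * W P μ ρs a b ρ v + 4 * E P ρs a b ρ v ≤ Ks * Vv := by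
    have : Ks * Vv = 4 * Vv + 4 * (Vv / r) := by rw [hKs]; ring
    rw [this]; linarith
  have hEd : v a ^ 2 / 2 + v b ^ 2 / 2 + (1 / 2) * (∫ x in a..b, ρ x * v x ^ 2) ≤ Vv / r := by
    refine le_trans ?_ hEV
    rw [E]; linarith
  have hva := sq_nonneg (v a)
  have hvb := sq_nonneg (v b)
  have cv := hp.continuousOn_v
  have cρx := hp.continuousOn_ρx
  have hI : (∫ x in a..b, v x ^ 2) ≤ 2 / m / r * Vv := by
    have h := hp.integral_mono ((continuousOn_const (c := m)).mul (cv.pow 2))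
      (hp.continuousOn_ρ.mul (cv.pow 2)) fun x hx =>
        mul_le_mul_of_nonneg_right (hρ x hx).1 (sq_nonneg (v x))
    have e : ∫ x in a..b, m * v x ^ 2 = m * ∫ x in a..b, v x ^ 2 :=
      intervalIntegral.integral_const_mul _ _
    have h' : m * (∫ x in a..b, v x ^ 2) ≤ ∫ x in a..b, ρ x * v x ^ 2 := e.symm.le.trans h
    have : 2 / m / r * Vv = 2 * (Vv / r) / m := by field_simp
    rw [this, le_div_iff₀ hm]
    linarith
  have hJ : (∫ x in a..b, ρx x ^ 2) ≤ Ks / (m * c ^ 2) * Vv := by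
    have h := hp.integral_mono (f := fun x => m * c ^ 2 * ρx x ^ 2)
      (g := fun x => ρ x * (μ (ρ x) / ρ x ^ 2 * ρx x) ^ 2)
      (continuousOn_const.mul (cρx.pow 2))
      (hp.continuousOn_ρ.mul (((hp.continuousOn_φ hH).mul cρx).pow 2)) fun x hx => by
        have h1 := (hB.φ_mem _ (hρ x hx)).1
        have h2 := pow_le_pow_left₀ hc.le h1 2
        rw [mul_pow, ← mul_assoc]
        exact mul_le_mul_of_nonneg_right
          (mul_le_mul (hρ x hx).1 h2 (sq_nonneg _) (hp.pos x hx).le) (sq_nonneg _)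
    have e : ∫ x in a..b, m * c ^ 2 * ρx x ^ 2 = m * c ^ 2 * ∫ x in a..b, ρx x ^ 2 :=
      intervalIntegral.integral_const_mul _ _
    have h3 := (e.symm.le.trans h).trans ((hp.integral_gradient_le hH hρs).trans hs)
    rw [div_mul_eq_mul_div, le_div_iff₀ (by positivity)]
    linarith
  have hd : (ρ b - ρs) ^ 2 ≤ Ks / c ^ 2 * Vv := by
    have h1 := (hp.k_sq_le hH hρs).trans hs
    obtain ⟨α, hα, e⟩ := hB.k_eq _ (hρ b (right_mem_Icc.2 hp.lt.le))
    rw [e, mul_pow] at h1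
    have h2 := mul_le_mul_of_nonneg_right (pow_le_pow_left₀ hc.le hα.1 2) (sq_nonneg (ρ b - ρs))
    rw [div_mul_eq_mul_div, le_div_iff₀ (by positivity)]
    linarith
  have e2 : 2 / r * Vv = 2 * (Vv / r) := by ring
  have hA : v a ^ 2 ≤ 2 / r * Vv := by rw [e2]; linarith
  have hBb : v b ^ 2 ≤ 2 / r * Vv := by rw [e2]; linarith
  rw [deviation, hK]
  linarith

/-- The dissipation rate controls the deviation from the equilibrium. -/
lemma deviation_le_dissipation (hH : AssumptionH P μ) (hB : CoeffBounds P μ ρs m M c C)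
    {r R : ℝ} (hr : 0 < r) (hR : 0 < R) : ∃ K, 0 < K ∧ ∀ (a b : ℝ) (ρ ρx v vx : ℝ → ℝ),
      IsProfile a b ρ ρx v → (∀ x ∈ Icc a b, ρ x ∈ Icc m M) →
      (∀ x ∈ Ioo a b, HasDerivAt v (vx x) x) → ContinuousOn vx (Icc a b) →
      deviation ρs a b ρ ρx v ≤ K * (R * v a ^ 2 + r * (∫ x in a..b, μ (ρ x) * vx x ^ 2)
        + (∫ x in a..b, μ (ρ x) / ρ x ^ 2 * deriv P (ρ x) * ρx x ^ 2)
        + k μ ρs (ρ b) * (P (ρ b) - P ρs) + 1 / 2 * (k μ ρs (ρ a) * (P (ρ a) - P ρs))) := by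
  have hm := hB.m_pos
  have hc := hB.c_pos
  set KA := 1 / R with hKA
  set KH := 1 / (r * c) with hKH
  -- The feedback damps only $v(a)$. The remaining velocities are reached through viscosity, by
  -- $v(x)^2\le2v(a)^2+2(b-a)\int v_x^2$.
  set o := 2 * KA + 2 * (1 / m * KH) with ho
  set K := KA + o + 1 / m * o + 1 / c ^ 2 + 1 / c ^ 2 with hK
  refine ⟨K, by positivity, fun a b ρ ρx v vx hp hρ hvx cvx => ?_⟩
  have cv := hp.continuousOn_v
  have cρx := hp.continuousOn_ρx
  have hb := right_mem_Icc.2 hp.lt.le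
  have ha := left_mem_Icc.2 hp.lt.le
  have hl := hp.length_le hm hρ
  have hkp : ∀ x ∈ Icc a b, c ^ 2 * (ρ x - ρs) ^ 2 ≤ k μ ρs (ρ x) * (P (ρ x) - P ρs) :=
    fun x hx => by
      obtain ⟨α, hα, e⟩ := hB.k_eq _ (hρ x hx)
      obtain ⟨β, hβ, e'⟩ := hB.P_sub _ (hρ x hx)
      have h1 : c * c ≤ α * β := mul_le_mul hα.1 hβ.1 hc.le (hc.le.trans hα.1)
      rw [e, e']
      nlinarith [mul_le_mul_of_nonneg_right h1 (sq_nonneg (ρ x - ρs))]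
  have hH1 : c * (∫ x in a..b, vx x ^ 2) ≤ ∫ x in a..b, μ (ρ x) * vx x ^ 2 := by
    rw [← intervalIntegral.integral_const_mul]
    exact hp.integral_mono (continuousOn_const.mul (cvx.pow 2))
      ((hp.continuousOn_comp hH.continuousOn_μ).mul (cvx.pow 2)) fun x hx =>
        mul_le_mul_of_nonneg_right (hB.le_μ _ (hρ x hx)) (sq_nonneg _)
  have hJ1 : c ^ 2 * (∫ x in a..b, ρx x ^ 2) ≤
      ∫ x in a..b, μ (ρ x) / ρ x ^ 2 * deriv P (ρ x) * ρx x ^ 2 := by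
    rw [← intervalIntegral.integral_const_mul]
    refine hp.integral_mono (continuousOn_const.mul (cρx.pow 2))
      (((hp.continuousOn_φ hH).mul (hp.continuousOn_comp hH.continuousOn_deriv_P)).mul
        (cρx.pow 2)) fun x hx => mul_le_mul_of_nonneg_right ?_ (sq_nonneg _)
    rw [sq]
    have h1 := (hB.φ_mem _ (hρ x hx)).1
    exact mul_le_mul h1 (hB.le_deriv_P _ (hρ x hx)) hc.le (hc.le.trans h1)
  have hI0 : 0 ≤ ∫ x in a..b, vx x ^ 2 :=
    intervalIntegral.integral_nonneg hp.lt.le fun _ _ => sq_nonneg _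
  have hJ0 := hp.integral_ρx_sq_nonneg
  have hkb := hkp b hb
  have hka := hkp a ha
  generalize (∫ x in a..b, μ (ρ x) * vx x ^ 2) = IH at hH1 ⊢
  generalize (∫ x in a..b, μ (ρ x) / ρ x ^ 2 * deriv P (ρ x) * ρx x ^ 2) = IJ at hJ1 ⊢
  generalize k μ ρs (ρ b) * (P (ρ b) - P ρs) = pb at hkb ⊢
  generalize k μ ρs (ρ a) * (P (ρ a) - P ρs) = pa at hka ⊢
  set D := R * v a ^ 2 + r * IH + IJ + pb + 1 / 2 * pa with hD
  have q1 : 0 ≤ R * v a ^ 2 := by positivity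
  have q2' : 0 ≤ IH := (mul_nonneg hc.le hI0).trans hH1
  have q2 : 0 ≤ r * IH := mul_nonneg hr.le q2'
  have q3 : 0 ≤ IJ := (mul_nonneg (sq_nonneg c) hJ0).trans hJ1
  have q4 : 0 ≤ pb := le_trans (by positivity) hkb
  have q5 : 0 ≤ pa := le_trans (by positivity) hka
  have hA : v a ^ 2 ≤ KA * D := by
    rw [hKA, one_div_mul_eq_div, le_div_iff₀ hR]; linarith
  have hHD : (∫ x in a..b, vx x ^ 2) ≤ KH * D := by
    rw [hKH, one_div_mul_eq_div, le_div_iff₀ (by positivity)]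
    have := mul_le_mul_of_nonneg_left hH1 hr.le
    linarith
  have hJ : (∫ x in a..b, ρx x ^ 2) ≤ 1 / c ^ 2 * D := by
    rw [one_div_mul_eq_div, le_div_iff₀ (by positivity)]; linarith
  have hd : (ρ b - ρs) ^ 2 ≤ 1 / c ^ 2 * D := by
    rw [one_div_mul_eq_div, le_div_iff₀ (by positivity)]; linarith
  have hD0 : 0 ≤ D := by linarith
  have hv : ∀ x ∈ Icc a b, v x ^ 2 ≤ o * D := fun x hx => by
    have h := sq_sub_le_mul_integral cv hvx cvx hp.lt hx ha
    have h2 : (b - a) * (∫ x in a..b, vx x ^ 2) ≤ 1 / m * (KH * D) :=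
      mul_le_mul hl hHD hI0 (by positivity)
    have e : o * D = 2 * (KA * D) + 2 * (1 / m * (KH * D)) := by rw [ho]; ring
    rw [e]
    nlinarith [sq_nonneg ((v x - v a) - v a)]
  have hI : (∫ x in a..b, v x ^ 2) ≤ 1 / m * o * D := by
    have h := hp.integral_mono (cv.pow 2) (continuousOn_const (c := o * D)) hv
    simp only [intervalIntegral.integral_const, smul_eq_mul, Pi.pow_apply] at h
    refine h.trans ((mul_le_mul_of_nonneg_right hl (by positivity)).trans (le_of_eq ?_))
    ring
  have hBb := hv b hb
  rw [deviation, hK]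
  linarith

end IsProfile

/-! ### Equivalence of the deviation with the state norm. -/

namespace IsProfile

variable {P μ : ℝ → ℝ} {a b ρs m M : ℝ} {ρ ρx v : ℝ → ℝ}

/-- The squares of the four summands of the state norm of the deviation from the equilibrium. -/
lemma exists_stateNorm_eq (hp : IsProfile a b ρ ρx v) (hm : 0 < m)
    (hρ : ∀ x ∈ Icc a b, ρ x ∈ Icc m M) :
    ∃ x₁ x₂ x₃ x₄ : ℝ, 0 ≤ x₁ ∧ 0 ≤ x₂ ∧ 0 ≤ x₃ ∧ 0 ≤ x₄ ∧
      stateNorm (Phi a b ρ v - equilibrium ρs) = x₁ + x₂ + x₃ + x₄ ∧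
      x₁ ^ 2 = v a ^ 2 + v b ^ 2 ∧ (b - a) * x₂ ^ 2 = (∫ x in a..b, v x ^ 2) ∧
      (ρ b - ρs) ^ 2 ≤ x₃ ^ 2 ∧ x₃ ^ 2 ≤ (2 + 2 / m) * deviation ρs a b ρ ρx v ∧
      x₄ ^ 2 = (b - a) * ∫ x in a..b, ρx x ^ 2 := by
  have hl := sub_pos.2 hp.lt
  have hmem : ∀ θ ∈ Icc (0 : ℝ) 1, a + (b - a) * θ ∈ Icc a b := fun θ hθ =>
    ⟨by nlinarith [hθ.1], by nlinarith [hθ.2]⟩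
  set o := (2 + 2 / m) * deviation ρs a b ρ ρx v with ho
  have hsup : ∀ θ ∈ Icc (0 : ℝ) 1, |ρ (a + (b - a) * θ) - ρs| ≤ √o := fun θ hθ =>
    Real.abs_le_sqrt (hp.sq_sub_le_deviation hm hρ (hmem θ hθ))
  have ho0 : 0 ≤ o := by
    have := hp.deviation_nonneg (ρs := ρs)
    positivity
  set s := (fun θ => |ρ (a + (b - a) * θ) - ρs|) '' Icc (0 : ℝ) 1 with hs
  have hsle : sSup s ≤ √o := by
    refine csSup_le ((nonempty_Icc.2 zero_le_one).image _) ?_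
    rintro _ ⟨θ, hθ, rfl⟩
    exact hsup θ hθ
  have hles : |ρ b - ρs| ≤ sSup s := by
    refine le_csSup ⟨√o, ?_⟩ ⟨1, by simp, by simp⟩
    rintro _ ⟨θ, hθ, rfl⟩
    exact hsup θ hθ
  have hs0 : 0 ≤ sSup s := (abs_nonneg _).trans hles
  -- The chain rule produces $(b-a)^2$, and the change of variables takes back one factor. The end
  -- points are dropped as a null set, since $\rho$ is known to be differentiable only inside.
  have hder : ∫ θ in (0 : ℝ)..1, deriv (fun θ => ρ (a + (b - a) * θ) - ρs) θ ^ 2 =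
      (b - a) * ∫ x in a..b, ρx x ^ 2 := by
    rw [integral_eq_integral_stretch a b fun x => ρx x ^ 2, ← intervalIntegral.integral_const_mul,
      intervalIntegral.integral_of_le zero_le_one, intervalIntegral.integral_of_le zero_le_one,
      integral_Ioc_eq_integral_Ioo, integral_Ioc_eq_integral_Ioo]
    refine setIntegral_congr_fun measurableSet_Ioo fun θ hθ => ?_
    have hx : a + (b - a) * θ ∈ Ioo a b := ⟨by nlinarith [hθ.1], by nlinarith [hθ.2]⟩
    have hd := (HasDerivAt.comp (h := fun θ => a + (b - a) * θ) θ (hp.hasDerivAt_ρ _ hx)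
      (((hasDerivAt_id θ).const_mul (b - a)).const_add a)).sub_const ρs
    have hd' : deriv (fun θ => ρ (a + (b - a) * θ) - ρs) θ = _ := hd.deriv
    simp only [hd']
    ring
  have hv2 : (b - a) * ∫ θ in (0 : ℝ)..1, v (a + (b - a) * θ) ^ 2 = ∫ x in a..b, v x ^ 2 := by
    rw [integral_eq_integral_stretch a b fun x => v x ^ 2, intervalIntegral.integral_const_mul]
  have hv0 : 0 ≤ ∫ θ in (0 : ℝ)..1, v (a + (b - a) * θ) ^ 2 :=
    intervalIntegral.integral_nonneg zero_le_one fun _ _ => sq_nonneg _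
  refine ⟨√(v a ^ 2 + v b ^ 2), √(∫ θ in (0 : ℝ)..1, v (a + (b - a) * θ) ^ 2), sSup s,
    √((b - a) * ∫ x in a..b, ρx x ^ 2), Real.sqrt_nonneg _, Real.sqrt_nonneg _, hs0,
    Real.sqrt_nonneg _, ?_, Real.sq_sqrt (by positivity), ?_, ?_, ?_, ?_⟩
  · rw [← hder]
    simp only [stateNorm, Phi, equilibrium, Prod.snd_sub, Prod.fst_sub, Pi.sub_apply, sub_zero,
      mul_zero, add_zero, mul_one, add_sub_cancel]
    rfl
  · rw [Real.sq_sqrt hv0, hv2]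
  · rw [← sq_abs (ρ b - ρs)]
    exact pow_le_pow_left₀ (abs_nonneg _) hles 2
  · calc sSup s ^ 2 ≤ √o ^ 2 := pow_le_pow_left₀ hs0 hsle 2
      _ = o := Real.sq_sqrt ho0
  · exact Real.sq_sqrt (mul_nonneg hl.le hp.integral_ρx_sq_nonneg)

/-- Passing to the unit interval costs powers of $b-a$, and unit mass places $b-a$ between $1/M$ and
$1/m$. -/
lemma stateNorm_equiv_deviation (hm : 0 < m) (hmM : m ≤ M) :
    ∃ K, 0 < K ∧ ∀ (a b : ℝ) (ρ ρx v : ℝ → ℝ),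
      IsProfile a b ρ ρx v → (∀ x ∈ Icc a b, ρ x ∈ Icc m M) →
      0 ≤ stateNorm (Phi a b ρ v - equilibrium ρs) ∧
      deviation ρs a b ρ ρx v ≤ K * stateNorm (Phi a b ρ v - equilibrium ρs) ^ 2 ∧
      stateNorm (Phi a b ρ v - equilibrium ρs) ^ 2 ≤ K * deviation ρs a b ρ ρx v := by
  have hM : 0 < M := hm.trans_le hmM
  refine ⟨(1 + 1 / m + 1 + M) + 4 * (2 + M + (2 + 2 / m) + 1 / m), by positivity,
    fun a b ρ ρx v hp hρ => ?_⟩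
  obtain ⟨x₁, x₂, x₃, x₄, h1, h2, h3, h4, hN, e1, e2, e3, e3', e4⟩ :=
    hp.exists_stateNorm_eq (ρs := ρs) hm hρ
  obtain ⟨hA, hB, hI, hJ, hd⟩ := hp.terms_le_deviation (ρs := ρs)
  have hn := hp.deviation_nonneg (ρs := ρs)
  have hI0 := hp.integral_v_sq_nonneg
  have hJ0 := hp.integral_ρx_sq_nonneg
  have hl1 := hp.length_le hm hρ
  have hl2 := hp.le_length hm hρ
  have hl := sub_pos.2 hp.lt
  have hlM : 1 ≤ M * (b - a) := by rwa [div_le_iff₀' hM] at hl2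
  rw [hN]
  refine ⟨by positivity, ?_, ?_⟩
  · set N := x₁ + x₂ + x₃ + x₄ with hNd
    have l1 : x₁ ^ 2 ≤ N ^ 2 := pow_le_pow_left₀ h1 (by linarith) 2
    have l2 : x₂ ^ 2 ≤ N ^ 2 := pow_le_pow_left₀ h2 (by linarith) 2
    have l3 : x₃ ^ 2 ≤ N ^ 2 := pow_le_pow_left₀ h3 (by linarith) 2
    have l4 : x₄ ^ 2 ≤ N ^ 2 := pow_le_pow_left₀ h4 (by linarith) 2
    have kI : (∫ x in a..b, v x ^ 2) ≤ 1 / m * N ^ 2 := by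
      rw [← e2]; exact mul_le_mul hl1 l2 (sq_nonneg _) (by positivity)
    have kJ : (∫ x in a..b, ρx x ^ 2) ≤ M * N ^ 2 := by
      calc (∫ x in a..b, ρx x ^ 2) ≤ M * (b - a) * ∫ x in a..b, ρx x ^ 2 :=
            le_mul_of_one_le_left hJ0 hlM
        _ = M * x₄ ^ 2 := by rw [e4]; ring
        _ ≤ _ := mul_le_mul_of_nonneg_left l4 hM.le
    have k0 : 0 ≤ 4 * (2 + M + (2 + 2 / m) + 1 / m) * N ^ 2 := by positivity
    rw [deviation, add_mul]
    linarith
  · set n := deviation ρs a b ρ ρx v with hnd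
    have l2 : x₂ ^ 2 ≤ M * n := by
      calc x₂ ^ 2 ≤ M * (b - a) * x₂ ^ 2 := le_mul_of_one_le_left (sq_nonneg _) hlM
        _ = M * ∫ x in a..b, v x ^ 2 := by rw [← e2]; ring
        _ ≤ _ := mul_le_mul_of_nonneg_left hI hM.le
    have l4 : x₄ ^ 2 ≤ 1 / m * n := by
      rw [e4]; exact mul_le_mul hl1 hJ hJ0 (by positivity)
    have hsq : (x₁ + x₂ + x₃ + x₄) ^ 2 ≤ 4 * (x₁ ^ 2 + x₂ ^ 2 + x₃ ^ 2 + x₄ ^ 2) := by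
      nlinarith [sq_nonneg (x₁ - x₂), sq_nonneg (x₁ - x₃), sq_nonneg (x₁ - x₄),
        sq_nonneg (x₂ - x₃), sq_nonneg (x₂ - x₄), sq_nonneg (x₃ - x₄)]
    have k0 : 0 ≤ (1 + 1 / m + 1 + M) * n := by positivity
    rw [add_mul]
    linarith

end IsProfile

/-! ### Continuity and dissipation of $V$ in closed loop. -/

/-- Both factors have the sign of $r-\rho^*$. No prior density bounds are needed, so this is
available before confinement. -/
lemma AssumptionH.k_mul_nonneg {P μ : ℝ → ℝ} (hH : AssumptionH P μ) {ρs r : ℝ} (hρs : 0 < ρs)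
    (hr : 0 < r) : 0 ≤ k μ ρs r * (P r - P ρs) := by
  obtain ⟨c, C, hB⟩ := hH.exists_coeffBounds (lt_min hρs hr) (min_le_left ρs r)
    (le_max_left ρs r)
  have hmem : r ∈ Icc (min ρs r) (max ρs r) := ⟨min_le_right _ _, le_max_right _ _⟩
  obtain ⟨α, hα, e⟩ := hB.k_eq r hmem
  obtain ⟨β, hβ, e'⟩ := hB.P_sub r hmem
  have h1 : 0 < α := hB.c_pos.trans_le hα.1
  have h2 : 0 < β := hB.c_pos.trans_le hβ.1
  rw [e, e']
  nlinarith [mul_nonneg (mul_pos h1 h2).le (sq_nonneg (r - ρs))]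

section Rates

variable {P μ : ℝ → ℝ} {ρs Pext : ℝ} {u a b : ℝ → ℝ} {ρ v : ℝ → ℝ → ℝ} {ρt ρx vt vx : ℝ × ℝ → ℝ}

/-- The balance laws hold only for $t>0$. Continuity up to $t=0$ links them to the initial data. -/
lemma IsClassicalSolution.continuousOn_V (hH : AssumptionH P μ) (hρs : 0 < ρs)
    (h : IsClassicalSolution P μ Pext u a b ρ v)
    (hp : HasPartials P μ Pext u a b ρ v ρt ρx vt vx) (r : ℝ) :
    ContinuousOn (fun t => V P μ ρs r (a t) (b t) (ρ t) (v t)) (Ici 0) := by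
  have ca : ContinuousOn a (Ici 0) := h.a_C1.continuousOn
  have cb : ContinuousOn b (Ici 0) := h.b_C1.continuousOn
  have hab : ∀ t ∈ Ici (0 : ℝ), a t ≤ b t := fun t ht => (h.a_lt_b t ht).le
  have cρ : ContinuousOn (fun p : ℝ × ℝ => ρ p.1 p.2) (closedDomain a b) := h.ρ_C1.1
  have cv : ContinuousOn (fun p : ℝ × ℝ => v p.1 p.2) (closedDomain a b) := h.v_C0
  have cφ := h.continuousOn_comp_ρ (hH.continuousOn_μ.div (continuousOn_pow 2)
    fun x hx => pow_ne_zero 2 (ne_of_gt hx))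
  have ck := h.continuousOn_comp_ρ (hH.continuousOn_k hρs)
  have bd : ∀ {f : ℝ × ℝ → ℝ} {c : ℝ → ℝ}, ContinuousOn f (closedDomain a b) →
      ContinuousOn c (Ici 0) → (∀ t ∈ Ici (0 : ℝ), (t, c t) ∈ closedDomain a b) →
      ContinuousOn (fun t => f (t, c t)) (Ici 0) := fun hf hc hm =>
    hf.comp (continuousOn_id.prodMk hc) hm
  have ma : ∀ t ∈ Ici (0 : ℝ), (t, a t) ∈ closedDomain a b := fun t ht => ⟨ht, le_rfl, hab t ht⟩
  have mb : ∀ t ∈ Ici (0 : ℝ), (t, b t) ∈ closedDomain a b := fun t ht => ⟨ht, hab t ht, le_rfl⟩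
  have i1 := continuousOn_integral_strip ca cb hab (f := fun p => ρ p.1 p.2 *
    (v p.1 p.2 + μ (ρ p.1 p.2) / ρ p.1 p.2 ^ 2 * ρx p) ^ 2)
    (cρ.mul ((cv.add (cφ.mul hp.continuousOn_ρx)).pow 2))
  have i2 := continuousOn_integral_strip ca cb hab (f := fun p => ρ p.1 p.2 * v p.1 p.2 ^ 2)
    (cρ.mul (cv.pow 2))
  have i3 := continuousOn_integral_strip ca cb hab (f := fun p => Q P ρs (ρ p.1 p.2))
    (h.continuousOn_comp_ρ (hH.continuousOn_Q hρs))
  have va := bd cv ca ma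
  have vb := bd cv cb mb
  have ka := bd ck ca ma
  have kb := bd ck cb mb
  have cW := (((continuousOn_const (c := (1 / 2 : ℝ))).mul i1).add
    ((continuousOn_const (c := (1 / 2 : ℝ))).mul ((vb.sub kb).pow 2))).add
    ((continuousOn_const (c := (1 / 2 : ℝ))).mul ((va.add ka).pow 2)) |>.add i3
  have cE := (((va.pow 2).div_const 2).add ((vb.pow 2).div_const 2)).add
    ((continuousOn_const (c := (1 / 2 : ℝ))).mul i2) |>.add i3
  refine (cW.add (continuousOn_const (c := r) |>.mul cE)).congr fun t ht => ?_
  simp only [V, W_eq hH hρs (h.isProfile hp ht)]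
  rfl

/-- The closed-loop dissipation inequality for the control Lyapunov functional. -/
lemma IsClassicalSolution.exists_hasDerivAt_V_le (hH : AssumptionH P μ) (hρs : 0 < ρs)
    (hP : P ρs = Pext) {K R : ℝ} (hK : 0 < K)
    (hA : ∀ ρ : ℝ, 0 < ρ → |k μ ρs ρ| ≤ K * |P ρ - P ρs|)
    (h : IsClassicalSolution P μ Pext u a b ρ v) (hu : ∀ t, 0 < t → u t = -R * v t (a t))
    (hp : HasPartials P μ Pext u a b ρ v ρt ρx vt vx) {t : ℝ} (ht : 0 < t) :
    ∃ V', HasDerivAt (fun t => V P μ ρs (R * K / 2) (a t) (b t) (ρ t) (v t)) V' t ∧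
      V' ≤ -(R * v t (a t) ^ 2
        + R * K / 2 * (∫ x in (a t)..(b t), μ (ρ t x) * vx (t, x) ^ 2)
        + (∫ x in (a t)..(b t), μ (ρ t x) / ρ t x ^ 2 * deriv P (ρ t x) * ρx (t, x) ^ 2)
        + k μ ρs (ρ t (b t)) * (P (ρ t (b t)) - P ρs)
        + 1 / 2 * (k μ ρs (ρ t (a t)) * (P (ρ t (a t)) - P ρs))) := by
  refine ⟨_, (h.hasDerivAt_W hH hρs hP hp ht).add
    ((h.hasDerivAt_E hH hρs hP hp ht).const_mul (R * K / 2)), ?_⟩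
  have hpos := h.ρ_pos t (a t) ht.le (left_mem_Icc.2 (h.a_lt_b t ht.le).le)
  have h1 := hH.k_mul_nonneg hρs hpos
  have h2 := hA _ hpos
  rw [hu t ht]
  generalize k μ ρs (ρ t (a t)) = ka at *
  generalize P (ρ t (a t)) - P ρs = pa at *
  have h3 : ka ^ 2 ≤ K * (ka * pa) := by
    calc ka ^ 2 = |ka| * |ka| := by rw [← sq, sq_abs]
      _ ≤ |ka| * (K * |pa|) := mul_le_mul_of_nonneg_left h2 (abs_nonneg _)
      _ = K * |ka * pa| := by rw [abs_mul]; ring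
      _ = K * (ka * pa) := by rw [abs_of_nonneg h1]
  -- Half of $k(P-P(\rho^*))$ at the left piston and the damping $rRv^2$ absorb the cross term
  -- $Rvk$. Multiplied by $K$, the sum is at least $\frac12(k+RKv)^2$, exactly for $r=RK/2$.
  have h4 : 0 ≤ 1 / 2 * (ka * pa) + R * v t (a t) * ka + R * (R * K / 2) * v t (a t) ^ 2 := by
    have h5 : 0 ≤ K * (1 / 2 * (ka * pa) + R * v t (a t) * ka
        + R * (R * K / 2) * v t (a t) ^ 2) := by
      nlinarith [sq_nonneg (ka + R * K * v t (a t))]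
    exact nonneg_of_mul_nonneg_right h5 hK
  nlinarith

end Rates

end TwoPiston

end

/-! ### Exponential decay. -/

theorem theorem2 (P μ : ℝ → ℝ) (hH : TwoPiston.AssumptionH P μ)
    (Pext : ℝ) (hPext : 0 < Pext)
    (ρs : ℝ) (hρs : 0 < ρs) (hρsP : P ρs = Pext)
    (K : ℝ) (hK : 0 < K)
    (hA : ∀ ρ : ℝ, 0 < ρ → |TwoPiston.k μ ρs ρ| ≤ K * |P ρ - P ρs|)
    (R : ℝ) (hR : 0 < R) (S : ℝ) (hS : 0 ≤ S) :
    ∃ M : ℝ, 0 < M ∧ ∃ σ : ℝ, 0 < σ ∧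
      ∀ r : ℝ, R * K / 2 ≤ r →
      ∀ (u a b : ℝ → ℝ) (ρ v : ℝ → ℝ → ℝ),
        TwoPiston.IsClassicalSolution P μ Pext u a b ρ v →
        (∀ t : ℝ, 0 < t → u t = -R * v t (a t)) →
        TwoPiston.V P μ ρs r (a 0) (b 0) (ρ 0) (v 0) ≤ S →
        ∀ t : ℝ, 0 ≤ t →
          TwoPiston.stateNorm
              (TwoPiston.Phi (a t) (b t) (ρ t) (v t) - TwoPiston.equilibrium ρs)
            ≤ M * Real.exp (-σ * t) *
              TwoPiston.stateNorm
                (TwoPiston.Phi (a 0) (b 0) (ρ 0) (v 0) - TwoPiston.equilibrium ρs) := by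
  have hr₀ : 0 < R * K / 2 := by positivity
  obtain ⟨m, M, hm, hmρ, hρM, hbd⟩ :=
    -- From $V\le S$ with weight $RK/2$ follow $W\le S$ and $E\le S/(RK/2)$.
    TwoPiston.IsProfile.exists_density_bounds hH hρs (max S (S / (R * K / 2)))
  obtain ⟨c, C, hB⟩ := hH.exists_coeffBounds hm hmρ hρM
  obtain ⟨K₁, hK₁, h₁⟩ := TwoPiston.IsProfile.V_le_deviation hH hρs hB hr₀.le
  obtain ⟨K₂, hK₂, h₂⟩ := TwoPiston.IsProfile.deviation_le_V hH hρs hB hr₀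
  obtain ⟨K₃, hK₃, h₃⟩ := TwoPiston.IsProfile.deviation_le_dissipation hH hB hr₀ hR
  obtain ⟨K₄, hK₄, h₄⟩ := TwoPiston.IsProfile.stateNorm_equiv_deviation (ρs := ρs) hm hB.le_M
  -- The functional decays at rate $1/(K_1K_3)$. Passing from squares to norms halves the rate and
  -- takes the root of the product of the equivalence constants.
  refine ⟨√(K₄ * K₂ * K₁ * K₄), by positivity, 1 / (K₁ * K₃) / 2, by positivity,
    fun r hr u a b ρ v h hu hV0 => ?_⟩
  obtain ⟨ρt, ρx, vt, vx, hp⟩ := h.exists_hasPartials hH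
  have hprof : ∀ t, 0 ≤ t → TwoPiston.IsProfile (a t) (b t) (ρ t) (fun x => ρx (t, x)) (v t) :=
    fun t ht => h.isProfile hp ht
  -- The weight is $RK/2$ whatever $r$ is. As $E\ge0$, the bound $S$ for the given $r$ carries over,
  -- so no constant depends on $r$.
  set F : ℝ → ℝ := fun t => TwoPiston.V P μ ρs (R * K / 2) (a t) (b t) (ρ t) (v t) with hF
  have hF0 : F 0 ≤ S := by
    refine le_trans ?_ hV0
    have := (hprof 0 le_rfl).E_nonneg hH hρs
    simp only [hF, TwoPiston.V]
    nlinarith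
  have cF : ContinuousOn F (Ici 0) := h.continuousOn_V hH hρs hp _
  have hder := fun {t : ℝ} (ht : 0 < t) =>
    h.exists_hasDerivAt_V_le hH hρs hρsP hK hA hu hp ht
  have hdF : ∀ t, 0 < t → DifferentiableAt ℝ F t := fun t ht => by
    obtain ⟨V', h1, -⟩ := hder ht
    exact h1.differentiableAt
  -- Monotonicity uses only signs, so it precedes the density bounds, which rest on it.
  have hanti : AntitoneOn F (Ici 0) := by
    refine antitoneOn_of_deriv_nonpos (convex_Ici 0) cF ?_ ?_
    · intro t ht
      rw [interior_Ici] at ht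
      exact (hdF t ht).differentiableWithinAt
    · intro t ht
      rw [interior_Ici] at ht
      have ht' : 0 < t := ht
      obtain ⟨V', h1, h2⟩ := hder ht'
      rw [h1.deriv]
      refine h2.trans (neg_nonpos.2 ?_)
      have hpr := hprof t ht'.le
      have hab := hpr.lt.le
      have q1 : 0 ≤ ∫ x in (a t)..(b t), μ (ρ t x) * vx (t, x) ^ 2 :=
        intervalIntegral.integral_nonneg hab fun x hx =>
          mul_nonneg (hH.μ_pos _ (hpr.pos x hx)).le (sq_nonneg _)
      have q2 : 0 ≤ ∫ x in (a t)..(b t), μ (ρ t x) / ρ t x ^ 2 * deriv P (ρ t x)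
          * ρx (t, x) ^ 2 :=
        intervalIntegral.integral_nonneg hab fun x hx => by
          have hx0 := hpr.pos x hx
          have k1 := hH.μ_pos _ hx0
          have k2 := hH.deriv_P_pos _ hx0
          positivity
      have q3 := hH.k_mul_nonneg hρs (hpr.pos (a t) (left_mem_Icc.2 hab))
      have q4 := hH.k_mul_nonneg hρs (hpr.pos (b t) (right_mem_Icc.2 hab))
      positivity
  have hdens : ∀ t, 0 ≤ t → ∀ x ∈ Icc (a t) (b t), ρ t x ∈ Icc m M := fun t ht => by
    have hFt : F t ≤ S := (hanti self_mem_Ici ht ht).trans hF0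
    have hpr := hprof t ht
    have hE := hpr.E_nonneg hH hρs
    have hW := hpr.W_nonneg hH hρs
    simp only [hF, TwoPiston.V] at hFt
    refine hbd _ _ _ _ _ hpr (le_trans ?_ (le_max_left _ _)) (le_trans ?_ (le_max_right _ _))
    · nlinarith
    · rw [le_div_iff₀ hr₀]
      linarith
  have hdecay : ∀ t, 0 < t → deriv F t ≤ -(1 / (K₁ * K₃)) * F t := fun t ht => by
    have hpr := hprof t ht.le
    obtain ⟨V', h1, h2⟩ := hder ht
    rw [h1.deriv]
    have h3 := h₃ _ _ _ _ _ (fun x => vx (t, x)) hpr (hdens t ht.le) (fun x hx => by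
      obtain ⟨L, k1, -, k2⟩ := hp.hasFDerivAt_v (t, x) ⟨ht, hx⟩
      rw [← k2]
      exact TwoPiston.hasDerivAt_slice k1) (TwoPiston.continuousOn_slice hp.continuousOn_vx ht)
    have h4 := h₁ _ _ _ _ _ hpr (hdens t ht.le)
    -- The dissipation is at most $-V'$ and controls the deviation, which controls $F$.
    have h5 : F t ≤ K₁ * (K₃ * -V') :=
      h4.trans (mul_le_mul_of_nonneg_left (h3.trans
        (mul_le_mul_of_nonneg_left (by linarith) hK₃.le)) hK₁.le)
    rw [neg_mul, one_div_mul_eq_div, le_neg, div_le_iff₀ (by positivity)]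
    linarith
  have hexp : ∀ t, 0 ≤ t → F t ≤ Real.exp (-(1 / (K₁ * K₃)) * t) * F 0 := fun t ht => by
    have hanti2 : AntitoneOn (fun t => Real.exp (1 / (K₁ * K₃) * t) * F t) (Ici 0) := by
      have hde : ∀ t, HasDerivAt (fun t => Real.exp (1 / (K₁ * K₃) * t))
          (Real.exp (1 / (K₁ * K₃) * t) * (1 / (K₁ * K₃))) t := fun t => by
        simpa using ((hasDerivAt_id t).const_mul (1 / (K₁ * K₃))).exp
      refine antitoneOn_of_deriv_nonpos (convex_Ici 0)
        ((Continuous.continuousOn (by fun_prop)).mul cF) ?_ ?_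
      · intro t ht
        rw [interior_Ici] at ht
        exact ((hde t).differentiableAt.mul (hdF t ht)).differentiableWithinAt
      · intro t ht
        rw [interior_Ici] at ht
        have e : deriv (fun t => Real.exp (1 / (K₁ * K₃) * t) * F t) t = _ :=
          ((hde t).mul (hdF t ht).hasDerivAt).deriv
        rw [e]
        have := mul_le_mul_of_nonneg_left (hdecay t ht) (Real.exp_pos (1 / (K₁ * K₃) * t)).le
        linarith
    have h1 := hanti2 self_mem_Ici ht ht
    simp only [mul_zero, Real.exp_zero, one_mul] at h1
    rw [neg_mul, Real.exp_neg, inv_mul_eq_div, le_div_iff₀ (Real.exp_pos _)]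
    linarith
  intro t ht
  obtain ⟨n0, -, n1⟩ := h₄ _ _ _ _ _ (hprof t ht) (hdens t ht)
  obtain ⟨m0, m1, -⟩ := h₄ _ _ _ _ _ (hprof 0 le_rfl) (hdens 0 le_rfl)
  have n2 := h₂ _ _ _ _ _ (hprof t ht) (hdens t ht)
  have m2 := h₁ _ _ _ _ _ (hprof 0 le_rfl) (hdens 0 le_rfl)
  have hM : 0 ≤ √(K₄ * K₂ * K₁ * K₄) := Real.sqrt_nonneg _
  refine le_of_sq_le_sq ?_ (by positivity)
  rw [mul_pow, mul_pow, Real.sq_sqrt (by positivity), ← Real.exp_nat_mul]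
  have e : ((2 : ℕ) : ℝ) * (-(1 / (K₁ * K₃) / 2) * t) = -(1 / (K₁ * K₃)) * t := by
    push_cast; ring
  rw [e]
  have hx := (Real.exp_pos (-(1 / (K₁ * K₃)) * t)).le
  calc _ ≤ K₄ * (K₂ * F t) := n1.trans (mul_le_mul_of_nonneg_left n2 hK₄.le)
    _ ≤ K₄ * (K₂ * (Real.exp (-(1 / (K₁ * K₃)) * t) * F 0)) := by gcongr; exact hexp t ht
    _ ≤ K₄ * (K₂ * (Real.exp (-(1 / (K₁ * K₃)) * t) * (K₁ * (K₄ * _)))) := by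
        gcongr
        exact m2.trans (mul_le_mul_of_nonneg_left m1 hK₁.le)
    _ = _ := by ring
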